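/- Let $B_1,\dots,B_N\subset\mathbb{R}^2$ be pairwise disjoint closed connected sets (the bodies and walls), let $D=\mathbb{R}^2\setminus\bigcup_i B_i$ be the fluid domain, and let the boundary of $D$ move with the velocity $V$, where $V:\mathbb{R}^2\to\mathbb{R}^2$ is a $C^1$ vector field for which the volume of each bounded $B_i$ does not change: $\int_{B_i}\nabla\cdot V\,dx=0$. Let $\rho>0$ be the constant fluid density. A *potential flow* on an open set $\Omega$ is the velocity field $\nabla\phi$ of a single-valued harmonic function $\phi$ on $\Omega$ (so it has zero circulation) with $\int_\Omega\|\nabla\phi\|^2<\infty$ that vanishes at infinity, i.e. for every $\delta>0$, $\nabla\phi(x)\to0$ as $\|x\|\to\infty$ through points of $\Omega$ at distance at least $\delta$ from $\mathbb{R}^2\setminus\Omega$ (this is $\nabla\phi(x)\to0$ as $\|x\|\to\infty$ in $\Omega$ if $\partial\Omega$ is bounded). Its boundary condition $(\nabla\phi-V)\cdot n=0$ on a part $\Gamma$ of $\partial\Omega$ is understood in the usual weak sense: $$\int_\Omega\big((\nabla\phi-V)\cdot\nabla\psi-\psi\,\nabla\cdot V\big)\,dx=0$$ for all $\psi\in C^1(\Omega)\cap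 H^1(\Omega)$ with bounded support that vanish near $\partial\Omega\setminus\Gamma$. Let $\nabla\phi$ be a potential flow on $D$ with $(\nabla\phi-V)\cdot n=0$ on $\partial D$. Suppose that a stationary impenetrable body $C$ is added to this flow, where $C\subset D$ is a closed set (in particular $\partial C\subset D$) and at least one of $\partial C$ and $\partial D$ is bounded. Then there exists a potential flow $\nabla\phi_C$ on $D\setminus C$ that satisfies the same condition $(\nabla\phi_C-V)\cdot n=0$ on $\partial D$ and the no-flux condition $\nabla\phi_C\cdot n=0$ on $\partial C$. Furthermore, every such flow has kinetic energy at least that of the flow without the body: $$\tfrac12\rho\int_{D\setminus C}\|\nabla\phi_C\|^2\,dx\ \ge\ \tfrac12\rho\int_D\|\nabla\phi\|^2\,dx .$$ -/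

import Mathlib

open MeasureTheory Filter Topology

noncomputable section

/-- The Euclidean plane `ℝ²`. -/
abbrev Plane : Type := EuclideanSpace ℝ (Fin 2)

/-- The divergence `∂₁V₁ + ∂₂V₂` of a vector field on the plane. -/
def divergence (V : Plane → Plane) (x : Plane) : ℝ :=
  ∑ i : Fin 2, (fderiv ℝ V x (EuclideanSpace.single i 1)) i

/-- The kinetic energy `½ ρ ∫_Ω ‖u‖²` of a velocity field `u` on `Ω`, for the constant density `ρ`. -/
def kineticEnergy (ρ : ℝ) (Ω : Set Plane) (u : Plane → Plane) : ℝ :=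
  1 / 2 * ρ * ∫ x in Ω, ‖u x‖ ^ 2

/-- The velocity field `u` on `Ω` vanishes at infinity: for every `δ > 0`, `u x → 0` as `‖x‖ → ∞`
through the points of `Ω` whose distance from the complement of `Ω` is at least `δ`. If the boundary
of `Ω` is bounded, this is plainly `u x → 0` as `‖x‖ → ∞` in `Ω`; if the boundary reaches infinity,
it leaves out the points next to the boundary, where the velocity may be infinite (sharp edges). -/
def VanishesAtInfinity (Ω : Set Plane) (u : Plane → Plane) : Prop :=
  ∀ δ > 0, Tendsto u (cocompact Plane ⊓ 𝓟 {x | Metric.ball x δ ⊆ Ω}) (𝓝 0)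

/-- Test functions on `Ω` for the Neumann problem: continuously differentiable functions on `Ω` of
class `H¹`, with bounded support. They need not vanish at the boundary of `Ω`, and on the two sides
of a thin piece of the boundary they are independent of each other. -/
structure IsNeumannTest (Ω : Set Plane) (ψ : Plane → ℝ) : Prop where
  contDiffOn : ContDiffOn ℝ 1 ψ Ω
  memLp : MemLp ψ 2 (volume.restrict Ω)
  memLp_gradient : MemLp (gradient ψ) 2 (volume.restrict Ω)
  bounded_support : ∃ R : ℝ, ∀ x ∈ Ω, R < ‖x‖ → ψ x = 0

/-- The weak form of the no-flux boundary condition `(u - V) · n = 0` on the part `Γ` of the boundary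
of `Ω`, for a divergence-free field `u` on `Ω` and a boundary that moves with the velocity `V`:
`∫_Ω ((u - V) · ∇ψ + ψ ∇·(u - V)) = 0` for all test functions `ψ` that vanish near the rest of the
boundary. (The integral equals `∫_Γ ψ (u - V) · n` when everything is smooth up to the boundary.) -/
def NoFlux (Ω Γ : Set Plane) (V u : Plane → Plane) : Prop :=
  ∀ ψ : Plane → ℝ, IsNeumannTest Ω ψ →
    (∃ U : Set Plane, IsOpen U ∧ frontier Ω \ Γ ⊆ U ∧ ∀ x ∈ U ∩ Ω, ψ x = 0) →
    ∫ x in Ω, (inner ℝ (u x - V x) (gradient ψ x) - ψ x * divergence V x) = 0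

/-- `φ` is the (single-valued) velocity potential of a potential flow on the open set `Ω`: it is
harmonic in `Ω`, the kinetic energy is finite, and the velocity vanishes at infinity. -/
structure IsPotentialFlow (Ω : Set Plane) (φ : Plane → ℝ) : Prop where
  harmonic : InnerProductSpace.HarmonicOnNhd φ Ω
  finite_energy : MemLp (gradient φ) 2 (volume.restrict Ω)
  vanishes : VanishesAtInfinity Ω (gradient φ)

/-- `φ` is a potential flow on `D` with the boundary `∂D` moving with the velocity `V`. -/
structure IsFlow (D : Set Plane) (V : Plane → Plane) (φ : Plane → ℝ) : Prop where
  potential : IsPotentialFlow D φ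
  noFlux : NoFlux D (frontier D) V (gradient φ)

/-- `φC` is a potential flow on `D \ C` with the boundary `∂D` moving with the velocity `V`, as
before, and with no flux through the boundary `∂C` of the stationary body `C`. -/
structure IsFlowWithBody (D C : Set Plane) (V : Plane → Plane) (φC : Plane → ℝ) : Prop where
  potential : IsPotentialFlow (D \ C) φC
  noFlux_domain : NoFlux (D \ C) (frontier D) V (gradient φC)
  noFlux_body : NoFlux (D \ C) (frontier C) 0 (gradient φC)

end

/-!
The flow around the body is obtained by Hilbert space methods, and the energy inequality is an
orthogonality relation. Neither needs any regularity of the boundaries.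

*Vanishing fluxes.* Let `g` be `C¹` with compact support and `∇g` supported in `D`. On each body `g`
is constant, since bodies are connected, and the constant is zero on unbounded bodies. As the volume
of bounded bodies is preserved, the boundary condition for `∇φ` yields `∫_D ∇φ · ∇g = 0`
(`IsFlow.integral_inner_gradient_eq_zero`): no net flux leaves a body, nor any group of bodies.

*Existence.* As `∂C` or `∂D` is bounded, there is a cutoff function `χ`, equal to one near `C` and
to zero near `∂D`, with `∇χ` compactly supported. Near the support of `∇χ` the field `∇φ` has a
single-valued stream function `θ` because its fluxes vanish (`exists_stream_function`). Hence
`u₀ = (1 - χ) ∇φ + θ (∇χ)^⊥` is a solenoidal field that agrees with `∇φ` near `∂D` and vanishes near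
`C`, so it satisfies both boundary conditions, in the weak sense. The orthogonal projection `v` of `u₀`
onto the `L²`-closure of the gradients of test functions has the same integrals against these
gradients as `u₀`, so it satisfies the same boundary conditions.

*Regularity.* `v` is weakly solenoidal and weakly irrotational. Mollification with the kernel
`(r² - ‖z‖²)₊³` reproduces such fields: testing with two explicit piecewise polynomial fields
(`four_mul_integral_bump_eq`) shows that the normalized mollification does not depend on `r`
(`smear_scaling`), and it converges to `v` almost everywhere as `r → 0` (`ae_smear_eq_smul`). So `v`
has a smooth representative, and by the Cauchy-Schwarz inequality on discs it vanishes at infinity.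
A continuous limit of gradients is the gradient of a single-valued function
(`InGradientClosure.exists_hasGradientAt`). Hence `v` is a potential flow
(`exists_isPotentialFlow`).

*Energy.* Let `u` be `∇φ_C`, extended by zero to `C`. The weak boundary conditions for `∇φ` and
`∇φ_C`, applied to `(1 - χ) ψ` and `χ ψ`, show that `u - ∇φ` is orthogonal in `L²(D)` to the
gradients of all test functions `ψ` on `D` (`IsFlowWithBody.integral_inner_sub_eq_zero`). Although
`φ` may be unbounded and need not have bounded support, `u - ∇φ` is also orthogonal to `∇φ`
(`integral_inner_gradient_eq_zero_of_forall_test`): `φ` is truncated to a bounded function and cut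
off by `η (x / n)`, and in the plane the Dirichlet integral of `η (x / n)` does not depend on `n`.
So `‖u‖² = ‖∇φ‖² + ‖u - ∇φ‖² ≥ ‖∇φ‖²` in `L²(D)`.
-/

noncomputable section

/-! ### Divergence, gradient and integration by parts -/

theorem HasFDerivAt.divergence_eq {V : Plane → Plane} {L : Plane →L[ℝ] Plane} {x : Plane}
    (h : HasFDerivAt V L x) :
    divergence V x = ∑ i : Fin 2, (L (EuclideanSpace.single i 1)) i := by
  rw [divergence, h.fderiv]

theorem Filter.EventuallyEq.divergence_eq {V W : Plane → Plane} {x : Plane} (h : V =ᶠ[𝓝 x] W) :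
    divergence V x = divergence W x := by
  simp only [divergence, h.fderiv_eq]

theorem divergence_zero (x : Plane) : divergence (0 : Plane → Plane) x = 0 := by
  simp [divergence]

theorem plane_inner (x y : Plane) : inner ℝ x y = x 0 * y 0 + x 1 * y 1 := by
  simp [PiLp.inner_apply, Fin.sum_univ_two, mul_comm]

theorem plane_eta (v : Plane) :
    v = v 0 • EuclideanSpace.single 0 1 + v 1 • EuclideanSpace.single 1 1 := by
  ext i; fin_cases i <;> simp

theorem divergence_smul {ψ : Plane → ℝ} {Y : Plane → Plane} {x : Plane}
    (hψ : DifferentiableAt ℝ ψ x) (hY : DifferentiableAt ℝ Y x) :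
    divergence (fun y => ψ y • Y y) x = inner ℝ (gradient ψ x) (Y x) + ψ x * divergence Y x := by
  rw [(hψ.hasFDerivAt.fun_smul hY.hasFDerivAt).divergence_eq]
  have : inner ℝ (gradient ψ x) (Y x) = fderiv ℝ ψ x (Y x) := inner_gradient_left ..
  rw [this]
  conv_rhs => rw [plane_eta (Y x)]
  simp [divergence, Fin.sum_univ_two]
  ring

theorem contDiff_fderiv_apply {E : Type*} [NormedAddCommGroup E] [NormedSpace ℝ E]
    {Y : Plane → E} (hY : ContDiff ℝ 1 Y) (e : Plane) :
    Continuous fun x => fderiv ℝ Y x e :=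
  (hY.continuous_fderiv one_ne_zero).clm_apply continuous_const

theorem continuous_divergence {Y : Plane → Plane} (hY : ContDiff ℝ 1 Y) :
    Continuous (divergence Y) := by
  unfold divergence
  refine continuous_finsetSum _ fun i _ => ?_
  exact (EuclideanSpace.proj (𝕜 := ℝ) i).continuous.comp (contDiff_fderiv_apply hY _)

theorem support_divergence_subset (Y : Plane → Plane) :
    Function.support (divergence Y) ⊆ tsupport Y := by
  intro x hx
  by_contra h
  refine hx ?_
  rw [(notMem_tsupport_iff_eventuallyEq.1 h).divergence_eq, divergence_zero]

theorem divergence_eq_zero_of_notMem {Y : Plane → Plane} {x : Plane} (hx : x ∉ tsupport Y) :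
    divergence Y x = 0 := by
  by_contra h
  exact hx (support_divergence_subset Y h)

theorem hasCompactSupport_divergence {Y : Plane → Plane} (hY : HasCompactSupport Y) :
    HasCompactSupport (divergence Y) :=
  hY.mono' (support_divergence_subset Y)

/-- The divergence theorem for compactly supported fields on the whole plane. -/
theorem integral_divergence_eq_zero {Y : Plane → Plane} (hY : ContDiff ℝ 1 Y)
    (hc : HasCompactSupport Y) : ∫ x, divergence Y x = 0 := by
  have hd (i : Fin 2) : ContDiff ℝ 1 fun x => Y x i :=
    (EuclideanSpace.proj (𝕜 := ℝ) i).contDiff.comp hY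
  have hcs (i : Fin 2) : HasCompactSupport fun x => Y x i :=
    hc.comp_left (g := fun v : Plane => v i) rfl
  have key (i : Fin 2) (x : Plane) : (fderiv ℝ Y x (EuclideanSpace.single i 1)) i
      = fderiv ℝ (fun x => Y x i) x (EuclideanSpace.single i 1) := by
    have := ((EuclideanSpace.proj (𝕜 := ℝ) i).hasFDerivAt.comp x
      ((hY.differentiable one_ne_zero) x).hasFDerivAt).fderiv
    simp only [Function.comp_def] at this
    erw [this]; rfl
  have hint (i : Fin 2) : Integrable fun x =>
      fderiv ℝ (fun x => Y x i) x (EuclideanSpace.single i 1) :=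
    (contDiff_fderiv_apply (hd i) _).integrable_of_hasCompactSupport
      ((hcs i).fderiv_apply (𝕜 := ℝ) _)
  have h0 (i : Fin 2) : ∫ x, fderiv ℝ (fun x => Y x i) x (EuclideanSpace.single i 1) = 0 := by
    have := integral_mul_fderiv_eq_neg_fderiv_mul_of_integrable (𝕜 := ℝ)
      (μ := (volume : Measure Plane)) (f := fun _ : Plane => (1 : ℝ)) (g := fun x => Y x i)
      (v := EuclideanSpace.single i 1) (by simp) (by simpa using hint i)
      (by simpa using (hd i).continuous.integrable_of_hasCompactSupport (hcs i))
      (fun _ _ => differentiableAt_const _) (fun x _ => (hd i).differentiable one_ne_zero x)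
    simpa using this
  simp only [divergence, key]
  rw [integral_finsetSum _ fun i _ => hint i]
  simp [h0]

theorem continuousOn_gradient {Ω : Set Plane} (hΩ : IsOpen Ω) {ψ : Plane → ℝ}
    (hψ : ContDiffOn ℝ 1 ψ Ω) : ContinuousOn (gradient ψ) Ω :=
  (InnerProductSpace.toDual ℝ Plane).symm.continuous.comp_continuousOn
    (hψ.continuousOn_fderiv_of_isOpen hΩ le_rfl)

theorem contDiff_gradient {n : WithTop ℕ∞} {ψ : Plane → ℝ} (hψ : ContDiff ℝ (n + 1) ψ) :
    ContDiff ℝ n (gradient ψ) :=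
  (InnerProductSpace.toDual ℝ Plane).symm.toContinuousLinearEquiv.contDiff.comp
    (hψ.fderiv_right le_rfl)

theorem gradient_eq_zero_of_notMem {ψ : Plane → ℝ} {x : Plane} (hx : x ∉ tsupport ψ) :
    gradient ψ x = 0 := by
  rw [(notMem_tsupport_iff_eventuallyEq.1 hx).gradient_eq]
  simp [gradient]

theorem hasCompactSupport_gradient {ψ : Plane → ℝ} (h : HasCompactSupport ψ) :
    HasCompactSupport (gradient ψ) :=
  h.mono' fun x hx => by
    by_contra h'
    exact hx (gradient_eq_zero_of_notMem h')

theorem gradient_fun_mul {f g : Plane → ℝ} {x : Plane} (hf : DifferentiableAt ℝ f x)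
    (hg : DifferentiableAt ℝ g x) :
    gradient (fun y => f y * g y) x = f x • gradient g x + g x • gradient f x := by
  simp [gradient, fderiv_fun_mul hf hg]

theorem gradient_fun_add {f g : Plane → ℝ} {x : Plane} (hf : DifferentiableAt ℝ f x)
    (hg : DifferentiableAt ℝ g x) :
    gradient (fun y => f y + g y) x = gradient f x + gradient g x := by
  simp [gradient, fderiv_fun_add hf hg]

/-- A product of a `Cⁿ` function on `Ω` and a `Cⁿ` function supported in `Ω` is `Cⁿ` on the
plane. -/
theorem contDiff_smul_of_tsupport_subset {E : Type*} [NormedAddCommGroup E] [NormedSpace ℝ E]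
    {n : WithTop ℕ∞} {Ω : Set Plane} (hΩ : IsOpen Ω)
    {ψ : Plane → ℝ} (hψ : ContDiffOn ℝ n ψ Ω) {Y : Plane → E} (hY : ContDiff ℝ n Y)
    (hs : tsupport Y ⊆ Ω) : ContDiff ℝ n fun x => ψ x • Y x := by
  rw [contDiff_iff_contDiffAt]
  intro x
  by_cases hx : x ∈ tsupport Y
  · exact (hψ.contDiffAt (hΩ.mem_nhds (hs hx))).smul hY.contDiffAt
  · refine (contDiffAt_const (c := (0 : E))).congr_of_eventuallyEq ?_
    filter_upwards [notMem_tsupport_iff_eventuallyEq.1 hx] with y hy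
    simp [hy]

/-- Integration by parts on `Ω`; no boundary term appears since `Y` vanishes near the boundary. -/
theorem integral_inner_gradient_eq_neg {Ω : Set Plane} (hΩ : IsOpen Ω) {ψ : Plane → ℝ}
    (hψ : ContDiffOn ℝ 1 ψ Ω) {Y : Plane → Plane} (hY : ContDiff ℝ 1 Y)
    (hc : HasCompactSupport Y) (hs : tsupport Y ⊆ Ω) :
    ∫ x in Ω, inner ℝ (gradient ψ x) (Y x) = - ∫ x in Ω, ψ x * divergence Y x := by
  have hZ := contDiff_smul_of_tsupport_subset hΩ hψ hY hs
  have hts : tsupport (fun x => ψ x • Y x) ⊆ tsupport Y := closure_mono fun x hx => by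
    contrapose! hx
    simp [Function.notMem_support.1 hx]
  have hZc : HasCompactSupport fun x => ψ x • Y x :=
    hc.of_isClosed_subset (isClosed_tsupport _) hts
  have h0 := integral_divergence_eq_zero hZ hZc
  have hout (x) (hx : x ∉ Ω) : divergence (fun x => ψ x • Y x) x = 0 :=
    divergence_eq_zero_of_notMem fun h => hx (hs (hts h))
  rw [← setIntegral_eq_integral_of_forall_compl_eq_zero hout] at h0
  have hψY : IntegrableOn (fun x => ψ x * divergence Y x) Ω := by
    have hcont : Continuous fun x => ψ x • divergence Y x :=
      (contDiff_smul_of_tsupport_subset (n := 0) hΩ (hψ.of_le zero_le_one)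
        (contDiff_zero.2 (continuous_divergence hY))
        ((closure_minimal (support_divergence_subset Y) (isClosed_tsupport Y)).trans hs)).continuous
    exact (hcont.integrable_of_hasCompactSupport
      (hasCompactSupport_divergence hc).mul_left).integrableOn
  have hdZ : IntegrableOn (divergence fun x => ψ x • Y x) Ω :=
    ((continuous_divergence hZ).integrable_of_hasCompactSupport
      (hasCompactSupport_divergence hZc)).integrableOn
  have heq : ∫ x in Ω, inner ℝ (gradient ψ x) (Y x) =
      ∫ x in Ω, (divergence (fun x => ψ x • Y x) x - ψ x * divergence Y x) := by
    apply setIntegral_congr_fun hΩ.measurableSet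
    intro x hx
    simp only
    rw [divergence_smul ((hψ.contDiffAt (hΩ.mem_nhds hx)).differentiableAt one_ne_zero)
      (hY.differentiable one_ne_zero x)]
    ring
  rw [heq, integral_sub hdZ hψY, h0, zero_sub]

/-- `u` is divergence-free in `Ω` in the sense of distributions. -/
def WeaklySolenoidal (Ω : Set Plane) (u : Plane → Plane) : Prop :=
  ∀ h : Plane → ℝ, ContDiff ℝ 1 h → HasCompactSupport h → tsupport h ⊆ Ω →
    ∫ x in Ω, inner ℝ (u x) (gradient h x) = 0

/-- `u` is orthogonal to the compactly supported solenoidal fields in `Ω`. This is implied by `u`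
being a gradient, and it implies that `u` is curl-free in the sense of distributions. -/
def WeaklyIrrotational (Ω : Set Plane) (u : Plane → Plane) : Prop :=
  ∀ Y : Plane → Plane, ContDiff ℝ 1 Y → HasCompactSupport Y → tsupport Y ⊆ Ω →
    (∀ x, divergence Y x = 0) → ∫ x in Ω, inner ℝ (u x) (Y x) = 0

theorem weaklyIrrotational_gradient {Ω : Set Plane} (hΩ : IsOpen Ω) {ψ : Plane → ℝ}
    (hψ : ContDiffOn ℝ 1 ψ Ω) : WeaklyIrrotational Ω (gradient ψ) := by
  intro Y hY hc hs hdiv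
  rw [integral_inner_gradient_eq_neg hΩ hψ hY hc hs]
  simp [hdiv]

/-! ### The mollifier -/

theorem hasDerivAt_max_zero_pow (n : ℕ) (t : ℝ) :
    HasDerivAt (fun t : ℝ => max t 0 ^ (n + 2)) ((n + 2) * max t 0 ^ (n + 1)) t := by
  rcases lt_trichotomy t 0 with h | h | h
  · rw [max_eq_right h.le]
    have : (fun t : ℝ => max t 0 ^ (n + 2)) =ᶠ[𝓝 t] fun _ => 0 := by
      filter_upwards [Iio_mem_nhds h] with s hs
      rw [max_eq_right (le_of_lt hs)]; simp
    simpa using (hasDerivAt_const t (0 : ℝ)).congr_of_eventuallyEq this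
  · subst h
    simp only [max_self, ne_eq, Nat.add_eq_zero_iff, one_ne_zero, and_false, not_false_eq_true,
      zero_pow, mul_zero]
    rw [hasDerivAt_iff_isLittleO_nhds_zero]
    simp only [zero_add, max_self, smul_zero, sub_zero]
    have h1 : (fun h : ℝ => max h 0 ^ (n + 2)) =O[𝓝 0] fun h : ℝ => h ^ (n + 2) := by
      refine Asymptotics.IsBigO.of_bound 1 (Eventually.of_forall fun h => ?_)
      rw [one_mul, norm_pow, norm_pow]
      gcongr
      rw [Real.norm_eq_abs, Real.norm_eq_abs, abs_of_nonneg (le_max_right h 0)]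
      exact max_le (le_abs_self h) (abs_nonneg h)
    have h2 : (fun h : ℝ => h ^ (n + 2)) =o[𝓝 0] fun h : ℝ => h := by
      simpa using Asymptotics.isLittleO_pow_pow (𝕜 := ℝ) (m := 1) (n := n + 2) (by omega)
    simpa using h1.trans_isLittleO h2
  · rw [max_eq_left h.le]
    have : (fun t : ℝ => max t 0 ^ (n + 2)) =ᶠ[𝓝 t] fun t => t ^ (n + 2) := by
      filter_upwards [Ioi_mem_nhds h] with s hs
      rw [max_eq_left (le_of_lt hs)]
    refine HasDerivAt.congr_of_eventuallyEq ?_ this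
    simpa using hasDerivAt_pow (n + 2) t

theorem contDiff_max_zero_pow (n : ℕ) : ContDiff ℝ n fun t : ℝ => max t 0 ^ (n + 1) := by
  induction n with
  | zero => simp only [Nat.cast_zero, contDiff_zero]; fun_prop
  | succ n ih =>
    rw [Nat.cast_add, Nat.cast_one, contDiff_succ_iff_deriv]
    refine ⟨fun t => (hasDerivAt_max_zero_pow n t).differentiableAt, by simp, ?_⟩
    have : deriv (fun t : ℝ => max t 0 ^ (n + 1 + 1)) =
        fun t : ℝ => ((n : ℝ) + 2) * max t 0 ^ (n + 1) :=
      funext fun t => (hasDerivAt_max_zero_pow n t).deriv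
    rw [this]
    exact contDiff_const.mul ih

/-- The profile `(r² - ‖z‖²)₊` of the mollifiers. -/
def bumpProfile (r : ℝ) (z : Plane) : ℝ := max (r ^ 2 - ‖z‖ ^ 2) 0

/-- The (not normalized) mollifier `(r² - ‖z‖²)₊³`. The exponent makes it of class `C²`. -/
def bump (r : ℝ) (z : Plane) : ℝ := bumpProfile r z ^ 3

theorem bumpProfile_nonneg (r : ℝ) (z : Plane) : 0 ≤ bumpProfile r z := le_max_right _ _

theorem bump_nonneg (r : ℝ) (z : Plane) : 0 ≤ bump r z := pow_nonneg (bumpProfile_nonneg r z) 3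

theorem bumpProfile_le (r : ℝ) (z : Plane) : bumpProfile r z ≤ r ^ 2 :=
  max_le (by nlinarith [sq_nonneg ‖z‖]) (sq_nonneg r)

theorem bump_le (r : ℝ) (z : Plane) : bump r z ≤ r ^ 6 :=
  calc bump r z ≤ (r ^ 2) ^ 3 := pow_le_pow_left₀ (bumpProfile_nonneg r z) (bumpProfile_le r z) 3
    _ = r ^ 6 := by ring

theorem contDiff_bumpProfile_pow (n : ℕ) (r : ℝ) :
    ContDiff ℝ n fun z => bumpProfile r z ^ (n + 1) :=
  (contDiff_max_zero_pow n).comp (contDiff_const.sub (contDiff_norm_sq ℝ))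

theorem contDiff_bump (r : ℝ) : ContDiff ℝ 2 (bump r) := contDiff_bumpProfile_pow 2 r

theorem continuous_bumpProfile (r : ℝ) : Continuous (bumpProfile r) := by
  unfold bumpProfile; fun_prop

theorem bumpProfile_eq_zero {r : ℝ} (hr : 0 ≤ r) {z : Plane} (hz : r ≤ ‖z‖) :
    bumpProfile r z = 0 :=
  max_eq_right (by nlinarith)

theorem bump_eq_zero {r : ℝ} (hr : 0 ≤ r) {z : Plane} (hz : r ≤ ‖z‖) : bump r z = 0 := by
  simp [bump, bumpProfile_eq_zero hr hz]

theorem hasCompactSupport_bump {r : ℝ} (hr : 0 ≤ r) : HasCompactSupport (bump r) :=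
  HasCompactSupport.intro (isCompact_closedBall (0 : Plane) r) fun z hz =>
    bump_eq_zero hr (by simpa using (not_le.1 (by simpa using hz)).le)

theorem bump_neg (r : ℝ) (z : Plane) : bump r (-z) = bump r z := by simp [bump, bumpProfile]

theorem hasFDerivAt_bumpProfile_pow (n : ℕ) (r : ℝ) (z : Plane) :
    HasFDerivAt (fun z => bumpProfile r z ^ (n + 2))
      ((-2 * (n + 2) * bumpProfile r z ^ (n + 1)) • innerSL ℝ z) z := by
  have h1 : HasFDerivAt (fun z : Plane => r ^ 2 - ‖z‖ ^ 2) (-(2 • innerSL ℝ z)) z := by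
    simpa using (hasStrictFDerivAt_norm_sq z).hasFDerivAt.const_sub (r ^ 2)
  refine ((hasDerivAt_max_zero_pow n _).comp_hasFDerivAt z h1).congr_fderiv ?_
  ext v
  simp [bumpProfile]
  ring

/-- The mass of the mollifier of radius one. -/
def bumpMass : ℝ := ∫ z, bump 1 z

theorem bumpMass_pos : 0 < bumpMass := by
  refine (contDiff_bump 1).continuous.integral_pos_of_hasCompactSupport_nonneg_nonzero
    (x := 0) (hasCompactSupport_bump zero_le_one) (bump_nonneg 1) ?_
  simp [bump, bumpProfile]

theorem integral_bump {r : ℝ} (hr : 0 < r) : ∫ z, bump r z = bumpMass * r ^ 8 := by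
  have h (z : Plane) : bump r (r • z) = r ^ 6 * bump 1 z := by
    simp only [bump, bumpProfile, norm_smul, mul_pow, Real.norm_eq_abs, sq_abs]
    rw [show r ^ 2 - r ^ 2 * ‖z‖ ^ 2 = r ^ 2 * (1 ^ 2 - ‖z‖ ^ 2) by ring,
      show max (r ^ 2 * (1 ^ 2 - ‖z‖ ^ 2)) 0 = r ^ 2 * max (1 ^ 2 - ‖z‖ ^ 2) 0 by
        rw [mul_max_of_nonneg _ _ (sq_nonneg r), mul_zero]]
    ring
  have h2 := Measure.integral_comp_smul (volume : Measure Plane) (bump r) r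
  simp only [h, integral_const_mul, finrank_euclideanSpace, Fintype.card_fin, smul_eq_mul] at h2
  rw [abs_of_pos (by positivity)] at h2
  rw [bumpMass]
  field_simp at h2
  linarith

/-- The (not normalized) mollification `x ↦ ∫ (r² - ‖x - y‖²)₊³ f(y) dy` of `f`. -/
def smear {E : Type*} [NormedAddCommGroup E] [NormedSpace ℝ E] (r : ℝ) (f : Plane → E)
    (x : Plane) : E :=
  ∫ y, bump r (x - y) • f y

section Smear

variable {E : Type*} [NormedAddCommGroup E] [NormedSpace ℝ E]

open scoped Convolution in
theorem smear_eq_convolution (r : ℝ) (f : Plane → E) :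
    smear r f = (f ⋆[(ContinuousLinearMap.lsmul ℝ ℝ : ℝ →L[ℝ] E →L[ℝ] E).flip, volume] bump r) := by
  ext x
  simp [smear, convolution_def]

theorem contDiff_smear {r : ℝ} (hr : 0 ≤ r) {f : Plane → E} (hf : LocallyIntegrable f) :
    ContDiff ℝ 2 (smear r f) := by
  rw [smear_eq_convolution]
  exact (hasCompactSupport_bump hr).contDiff_convolution_right (n := 2) _ hf (contDiff_bump r)

theorem fderiv_smear_apply {r : ℝ} (hr : 0 ≤ r) {f : Plane → E} (hf : LocallyIntegrable f)
    (x e : Plane) : fderiv ℝ (smear r f) x e = ∫ y, fderiv ℝ (bump r) (x - y) e • f y := by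
  have hb : ContDiff ℝ 1 (bump r) := (contDiff_bump r).of_le (by norm_num)
  have h := ((hasCompactSupport_bump hr).hasFDerivAt_convolution_right
    (ContinuousLinearMap.lsmul ℝ ℝ : ℝ →L[ℝ] E →L[ℝ] E).flip hf hb x).fderiv
  rw [smear_eq_convolution, h, convolution_precompR_apply _ hf
    ((hasCompactSupport_bump hr).fderiv ℝ) (hb.continuous_fderiv one_ne_zero)]
  simp [convolution_def]

theorem integrable_smul_of_locallyIntegrable {k : Plane → ℝ} (hk : Continuous k)
    (hc : HasCompactSupport k) {f : Plane → E} (hf : LocallyIntegrable f) (x : Plane) :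
    Integrable fun y => k (x - y) • f y := by
  have := hf.integrable_smul_left_of_hasCompactSupport (g := fun y => k (x - y))
    (by fun_prop) (hc.comp_homeomorph (Homeomorph.subLeft x))
  exact this

end Smear

/-! ### The mean value property of weakly harmonic fields -/

theorem hasGradientAt_bumpProfile_pow (n : ℕ) (r : ℝ) (x y : Plane) :
    HasGradientAt (fun y => bumpProfile r (y - x) ^ (n + 2))
      ((-2 * (n + 2) * bumpProfile r (y - x) ^ (n + 1)) • (y - x)) y := by
  rw [hasGradientAt_iff_hasFDerivAt]
  refine ((hasFDerivAt_bumpProfile_pow n r (y - x)).comp y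
    ((hasFDerivAt_id y).sub_const x)).congr_fderiv ?_
  ext v
  simp [InnerProductSpace.toDual_apply_apply]

theorem hasGradientAt_inner_sub (x e y : Plane) :
    HasGradientAt (fun y => inner ℝ (y - x) e) e y := by
  rw [hasGradientAt_iff_hasFDerivAt]
  refine (((hasFDerivAt_id y).sub_const x).inner ℝ (hasFDerivAt_const e y)).congr_fderiv ?_
  ext v
  simp [InnerProductSpace.toDual_apply_apply, real_inner_comm]

theorem hasGradientAt_norm_sub_sq (x y : Plane) :
    HasGradientAt (fun y => ‖y - x‖ ^ 2) ((2 : ℝ) • (y - x)) y := by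
  rw [hasGradientAt_iff_hasFDerivAt]
  refine ((hasStrictFDerivAt_norm_sq (y - x)).hasFDerivAt.comp y
    ((hasFDerivAt_id y).sub_const x)).congr_fderiv ?_
  ext v
  simp [InnerProductSpace.toDual_apply_apply]

theorem divergence_sub {V W : Plane → Plane} {x : Plane} (hV : DifferentiableAt ℝ V x)
    (hW : DifferentiableAt ℝ W x) :
    divergence (fun y => V y - W y) x = divergence V x - divergence W x := by
  simp [divergence, fderiv_fun_sub hV hW]

theorem divergence_const (e x : Plane) : divergence (fun _ => e) x = 0 := by
  simp [divergence]

theorem divergence_sub_const_id (a x : Plane) : divergence (fun y => y - a) x = 2 := by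
  have h : HasFDerivAt (fun y : Plane => y - a) (ContinuousLinearMap.id ℝ Plane) x :=
    (hasFDerivAt_id x).sub_const a
  rw [h.divergence_eq]
  simp

/-- A weakly solenoidal and weakly irrotational field is tested with
`∇ (q³ ⟨z, e⟩)` and with the solenoidal field `q³ e - 6 q² (‖z‖² e - ⟨z, e⟩ z)`,
where `q = (r² - ‖z‖²)₊` and `z = y - x`. In the sum of both, only multiples of `e` remain. -/
theorem four_mul_integral_bump_eq {Ω : Set Plane} {u : Plane → Plane}
    (hsol : WeaklySolenoidal Ω u) (hirr : WeaklyIrrotational Ω u)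
    (hu : LocallyIntegrable (Ω.indicator u)) (hΩ : IsOpen Ω) {x : Plane}
    {r : ℝ} (hr : 0 ≤ r) (hx : Metric.closedBall x r ⊆ Ω) (e : Plane) :
    4 * ∫ y in Ω, inner ℝ (u y) e * bumpProfile r (y - x) ^ 3 =
      3 * r ^ 2 * ∫ y in Ω, inner ℝ (u y) e * bumpProfile r (y - x) ^ 2 := by
  set q : Plane → ℝ := fun y => bumpProfile r (y - x) with hq
  have hq2 (n : ℕ) : ContDiff ℝ n fun y => q y ^ (n + 1) :=
    (contDiff_bumpProfile_pow n r).comp (contDiff_id.sub contDiff_const)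
  have hq0 (y) (hy : y ∉ Metric.closedBall x r) : q y = 0 :=
    bumpProfile_eq_zero hr (by rw [← dist_eq_norm]; exact (not_le.1 hy).le)
  set h : Plane → ℝ := fun y => q y ^ 3 * inner ℝ (y - x) e with hh
  set Z : Plane → Plane := fun y => ‖y - x‖ ^ 2 • e - inner ℝ (y - x) e • (y - x) with hZ
  set Y : Plane → Plane := fun y => q y ^ 3 • e - q y ^ 2 • ((6 : ℝ) • Z y) with hY
  have hin : ContDiff ℝ 1 fun y : Plane => (inner ℝ (y - x) e : ℝ) :=
    (contDiff_id.sub contDiff_const).inner ℝ contDiff_const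
  have hZd : ContDiff ℝ 1 Z :=
    (((contDiff_id.sub contDiff_const).norm_sq ℝ).smul contDiff_const).sub
      (hin.smul (contDiff_id.sub contDiff_const))
  have hq3d : ContDiff ℝ 1 fun y => q y ^ 3 := (hq2 2).of_le (by norm_num)
  have hq2d : ContDiff ℝ 1 fun y => q y ^ 2 := hq2 1
  have hhd : ContDiff ℝ 1 h := hq3d.mul hin
  have hYd : ContDiff ℝ 1 Y := (hq3d.smul contDiff_const).sub (hq2d.smul (hZd.const_smul 6))
  have hcomp {E : Type} [NormedAddCommGroup E] (f : Plane → E)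
      (hf : ∀ y, q y = 0 → f y = 0) : HasCompactSupport f ∧ tsupport f ⊆ Ω := by
    refine ⟨HasCompactSupport.intro (isCompact_closedBall x r) fun y hy => hf y (hq0 y hy), ?_⟩
    refine (closure_minimal (fun y hy => ?_) Metric.isClosed_closedBall).trans hx
    by_contra hc
    exact hy (hf y (hq0 y hc))
  have hhc := hcomp h fun y hy => by simp [hh, hy]
  have hYc := hcomp Y fun y hy => by simp [hY, hy]
  have hgrad (y) : gradient h y = q y ^ 3 • e - (6 * q y ^ 2 * inner ℝ (y - x) e) • (y - x) := by
    have h1 := hasGradientAt_bumpProfile_pow 1 r x y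
    have h2 := hasGradientAt_inner_sub x e y
    rw [hh, gradient_fun_mul h1.differentiableAt h2.differentiableAt, h1.gradient, h2.gradient,
      smul_smul, sub_eq_add_neg (_ • e), ← neg_smul]
    congr 2
    simp only [hq]
    push_cast
    ring
  have hdivZ (y) : divergence Z y = - inner ℝ (y - x) e := by
    have h2 := hasGradientAt_inner_sub x e y
    have h3 := hasGradientAt_norm_sub_sq x y
    have h4 : DifferentiableAt ℝ (fun y : Plane => y - x) y := by fun_prop
    rw [hZ, divergence_sub (h3.differentiableAt.smul_const e) (h2.differentiableAt.fun_smul h4),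
      divergence_smul h3.differentiableAt (by fun_prop),
      divergence_smul h2.differentiableAt h4, divergence_const,
      divergence_sub_const_id, h2.gradient, h3.gradient, real_inner_smul_left,
      real_inner_comm (y - x) e]
    ring
  have hdiv (y) : divergence Y y = 0 := by
    have h1 := hasGradientAt_bumpProfile_pow 1 r x y
    have h2 := hasGradientAt_bumpProfile_pow 0 r x y
    have hdZ : divergence (fun y => (6 : ℝ) • Z y) y = 6 * divergence Z y := by
      rw [divergence_smul (ψ := fun _ => (6 : ℝ)) (by fun_prop)
        (hZd.differentiable one_ne_zero y)]
      simp
    have hZi : inner ℝ (y - x) (Z y) = 0 := by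
      simp only [hZ]
      rw [inner_sub_right, real_inner_smul_right, real_inner_smul_right,
        real_inner_self_eq_norm_sq]
      ring
    have h6 : DifferentiableAt ℝ (fun y => (6 : ℝ) • Z y) y :=
      (hZd.differentiable one_ne_zero y).fun_const_smul 6
    rw [hY, divergence_sub (h1.differentiableAt.smul_const e) (h2.differentiableAt.fun_smul h6),
      divergence_smul h1.differentiableAt (by fun_prop),
      divergence_smul h2.differentiableAt h6, divergence_const, hdZ, hdivZ,
      h1.gradient, h2.gradient, real_inner_smul_left,
      real_inner_smul_left, real_inner_smul_right, hZi]
    push_cast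
    ring
  have e1 := hsol h hhd hhc.1 hhc.2
  have e2 := hirr Y hYd hYc.1 hYc.2 hdiv
  have hint (g : Plane → Plane) (hg : Continuous g) (hgc : HasCompactSupport g) :
      IntegrableOn (fun y => inner ℝ (u y) (g y)) Ω := by
    have hcoord (i : Fin 2) : Integrable fun y => g y i • Ω.indicator u y :=
      hu.integrable_smul_left_of_hasCompactSupport
        ((EuclideanSpace.proj (𝕜 := ℝ) i).continuous.comp hg)
        (hgc.comp_left (g := fun v : Plane => v i) rfl)
    have hsum := ((EuclideanSpace.proj (𝕜 := ℝ) (0 : Fin 2)).integrable_comp (hcoord 0)).add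
      ((EuclideanSpace.proj (𝕜 := ℝ) (1 : Fin 2)).integrable_comp (hcoord 1))
    refine hsum.integrableOn.congr_fun (fun y hy => ?_) hΩ.measurableSet
    simp [Set.indicator_of_mem hy, plane_inner, mul_comm]
  have hscal (k : ℕ) : IntegrableOn (fun y => inner ℝ (u y) e * q y ^ (k + 1)) Ω := by
    have hk : Continuous fun y => q y ^ (k + 1) • e :=
      ((hq2 k).continuous).smul continuous_const
    refine (hint _ hk (hcomp _ fun y hy => by simp [hy]).1).congr_fun (fun y _ => ?_)
      hΩ.measurableSet
    simp only [real_inner_smul_right]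
    ring
  have hgc : Continuous (gradient h) :=
    (contDiff_gradient (n := 0) (by simpa using hhd)).continuous
  have i1 := hint _ hgc (hasCompactSupport_gradient hhc.1)
  have i2 := hint Y hYd.continuous hYc.1
  have hsum : ∫ y in Ω, (inner ℝ (u y) (gradient h y) + inner ℝ (u y) (Y y)) = 0 := by
    rw [integral_add i1 i2, e1, e2, add_zero]
  have hpt (y : Plane) : inner ℝ (u y) (gradient h y) + inner ℝ (u y) (Y y)
      = 8 * (inner ℝ (u y) e * q y ^ 3) - 6 * r ^ 2 * (inner ℝ (u y) e * q y ^ 2) := by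
    rw [hgrad]
    simp only [hY, hZ, inner_sub_right, real_inner_smul_right]
    have hn : q y ^ 2 * ‖y - x‖ ^ 2 = q y ^ 2 * (r ^ 2 - q y) := by
      by_cases h0 : q y = 0
      · simp [h0]
      · congr 1
        simp only [hq, bumpProfile] at h0 ⊢
        rw [max_eq_left (by by_contra hlt; exact h0 (max_eq_right (not_le.1 hlt).le))]
        ring
    linear_combination (-6 * inner ℝ (u y) e) * hn
  rw [integral_congr_ae (Eventually.of_forall hpt), integral_sub ((hscal 2).const_mul _)
    ((hscal 1).const_mul _), integral_const_mul, integral_const_mul] at hsum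
  linarith

theorem hasDerivAt_integral_bumpProfile_pow {a : Plane → ℝ} {μ : Measure Plane}
    (ha : Integrable a μ) (x : Plane) (r : ℝ) :
    HasDerivAt (fun s => ∫ y, a y * bumpProfile s (y - x) ^ 3 ∂μ)
      (6 * r * ∫ y, a y * bumpProfile r (y - x) ^ 2 ∂μ) r := by
  have hm (s : ℝ) (k : ℕ) : AEStronglyMeasurable (fun y => a y * bumpProfile s (y - x) ^ k) μ :=
    ha.aestronglyMeasurable.mul
      (((continuous_bumpProfile s).comp (continuous_sub_right x)).pow k).aestronglyMeasurable
  have hd (s : ℝ) (y : Plane) : HasDerivAt (fun s => a y * bumpProfile s (y - x) ^ 3)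
      (a y * bumpProfile s (y - x) ^ 2 * (6 * s)) s := by
    have h1 := (hasDerivAt_max_zero_pow 1 (s ^ 2 - ‖y - x‖ ^ 2)).comp s
      ((hasDerivAt_pow 2 s).sub_const _)
    have h2 := h1.const_mul (a y)
    refine h2.congr_deriv ?_
    simp only [bumpProfile]
    push_cast
    ring
  have hb (s : ℝ) (y : Plane) (k : ℕ) : ‖bumpProfile s (y - x) ^ k‖ ≤ (s ^ 2) ^ k := by
    rw [Real.norm_of_nonneg (pow_nonneg (bumpProfile_nonneg _ _) k)]
    exact pow_le_pow_left₀ (bumpProfile_nonneg _ _) (bumpProfile_le _ _) k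
  have key := hasDerivAt_integral_of_dominated_loc_of_deriv_le (μ := μ)
    (F := fun s y => a y * bumpProfile s (y - x) ^ 3)
    (F' := fun s y => a y * bumpProfile s (y - x) ^ 2 * (6 * s)) (x₀ := r)
    (bound := fun y => ‖a y‖ * (((|r| + 1) ^ 2) ^ 2 * (6 * (|r| + 1))))
    (Metric.ball_mem_nhds r one_pos)
    (Eventually.of_forall fun s => hm s 3)
    (ha.mul_bdd (c := (r ^ 2) ^ 3)
      (((continuous_bumpProfile r).comp (continuous_sub_right x)).pow 3).aestronglyMeasurable
      (Eventually.of_forall fun y => hb r y 3))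
    ((hm r 2).mul_const _)
    (Eventually.of_forall fun y s hs => by
      have hs' : |s| ≤ |r| + 1 := by
        have h1 : |s - r| < 1 := by simpa [Real.dist_eq] using hs
        linarith [abs_sub_abs_le_abs_sub s r]
      rw [norm_mul, norm_mul, mul_assoc]
      have h2 := hb s y 2
      have h3 : ‖6 * s‖ ≤ 6 * (|r| + 1) := by
        rw [norm_mul, Real.norm_eq_abs s]; norm_num; exact hs'
      have h4 : (s ^ 2) ^ 2 ≤ ((|r| + 1) ^ 2) ^ 2 := by
        rw [← sq_abs s]; gcongr
      gcongr
      exact h2.trans h4)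
    (ha.norm.mul_const _)
    (Eventually.of_forall fun y s _ => hd s y)
  refine key.2.congr_deriv ?_
  rw [integral_mul_const]
  ring

theorem locallyIntegrable_indicator {E : Type*} [NormedAddCommGroup E] {Ω : Set Plane}
    (hΩ : IsOpen Ω) {u : Plane → E} (hu : MemLp u 2 (volume.restrict Ω)) :
    LocallyIntegrable (Ω.indicator u) :=
  ((memLp_indicator_iff_restrict hΩ.measurableSet).2 hu).locallyIntegrable (by norm_num)

theorem inner_smear_indicator {Ω : Set Plane} (hΩ : IsOpen Ω) {u : Plane → Plane}
    (hu : LocallyIntegrable (Ω.indicator u)) {r : ℝ} (hr : 0 ≤ r) (x e : Plane) :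
    inner ℝ (smear r (Ω.indicator u) x) e = ∫ y in Ω, inner ℝ (u y) e * bump r (y - x) := by
  rw [smear, real_inner_comm, ← integral_inner (integrable_smul_of_locallyIntegrable
    (contDiff_bump r).continuous (hasCompactSupport_bump hr) hu x), ← integral_indicator
    hΩ.measurableSet]
  congr 1
  ext y
  rw [← bump_neg r (x - y), neg_sub]
  by_cases hy : y ∈ Ω
  · simp [hy, real_inner_smul_right, real_inner_comm, mul_comm]
  · simp [hy]

/-- The normalized mollification of a weakly harmonic field at a point does not depend on the
radius, as long as the disc is contained in the domain: by `four_mul_integral_bump_eq`, the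
derivative with respect to the radius is zero. -/
theorem smear_scaling {Ω : Set Plane} (hΩ : IsOpen Ω) {u : Plane → Plane}
    (hsol : WeaklySolenoidal Ω u) (hirr : WeaklyIrrotational Ω u)
    (hu : LocallyIntegrable (Ω.indicator u)) {x : Plane} {r R : ℝ} (hr : 0 < r) (hrR : r ≤ R)
    (hx : Metric.closedBall x R ⊆ Ω) :
    (r ^ 8)⁻¹ • smear r (Ω.indicator u) x = (R ^ 8)⁻¹ • smear R (Ω.indicator u) x := by
  refine ext_inner_right ℝ fun e => ?_
  have hR : 0 < R := hr.trans_le hrR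
  rw [real_inner_smul_left, real_inner_smul_left, inner_smear_indicator hΩ hu hr.le,
    inner_smear_indicator hΩ hu hR.le]
  have hloc (k : ℕ) {s : ℝ} (hs : 0 < s) (hsR : s ≤ R) :
      ∫ y in Ω, inner ℝ (u y) e * bumpProfile s (y - x) ^ (k + 1) =
        ∫ y in Metric.closedBall x R, inner ℝ (u y) e * bumpProfile s (y - x) ^ (k + 1) := by
    refine setIntegral_eq_of_subset_of_forall_sdiff_eq_zero hΩ.measurableSet hx fun y hy => ?_
    rw [bumpProfile_eq_zero hs.le]
    · simp
    · rw [← dist_eq_norm]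
      exact hsR.trans (not_le.1 (fun h => hy.2 h)).le
  have ha : IntegrableOn (fun y => inner ℝ (u y) e) (Metric.closedBall x R) := by
    have h1 : IntegrableOn u (Metric.closedBall x R) :=
      (hu.integrableOn_isCompact (isCompact_closedBall x R)).congr_fun
        (fun y hy => Set.indicator_of_mem (hx hy) u) Metric.isClosed_closedBall.measurableSet
    exact Integrable.inner_const h1 e
  have hder (s) (hs : s ∈ Set.Icc r R) : HasDerivAt
      (fun s => (s ^ 8)⁻¹ * ∫ y in Metric.closedBall x R,
        inner ℝ (u y) e * bumpProfile s (y - x) ^ 3) 0 s := by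
    have hs0 : 0 < s := hr.trans_le hs.1
    have h1 := ((hasDerivAt_pow 8 s).fun_inv (by positivity)).fun_mul
      (hasDerivAt_integral_bumpProfile_pow ha x s)
    refine h1.congr_deriv ?_
    have h2 := four_mul_integral_bump_eq hsol hirr hu hΩ hs0.le
      ((Metric.closedBall_subset_closedBall hs.2).trans hx) e
    rw [hloc 2 hs0 hs.2, hloc 1 hs0 hs.2] at h2
    simp only [Nat.reduceAdd] at h2
    field_simp
    push_cast
    linear_combination (-2) * s ^ 7 * h2
  have hconst := constant_of_has_deriv_right_zero
    (fun s hs => (hder s hs).continuousAt.continuousWithinAt)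
    (fun s hs => (hder s ⟨hs.1, hs.2.le⟩).hasDerivWithinAt) R ⟨hrR, le_rfl⟩
  have h3 := hloc 2 hr hrR
  have h4 := hloc 2 hR le_rfl
  simp only [Nat.reduceAdd] at h3 h4
  simp only [bump]
  rw [h3, h4]
  exact hconst.symm

section

variable {E : Type*} [NormedAddCommGroup E] [NormedSpace ℝ E]

theorem smear_sub_smul [CompleteSpace E] {r : ℝ} (hr : 0 < r) {f : Plane → E}
    (hf : LocallyIntegrable f) (x : Plane) (v : E) :
    smear r f x - (bumpMass * r ^ 8) • v = ∫ y, bump r (x - y) • (f y - v) := by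
  have h1 : ∫ y, bump r (x - y) = bumpMass * r ^ 8 := by
    rw [integral_sub_left_eq_self (bump r) volume x, integral_bump hr]
  have hi : Integrable fun y => bump r (x - y) := by
    have := ((contDiff_bump r).continuous.integrable_of_hasCompactSupport
      (hasCompactSupport_bump hr.le) (μ := volume)).comp_sub_left x
    exact this
  simp only [smul_sub]
  rw [integral_sub (integrable_smul_of_locallyIntegrable (contDiff_bump r).continuous
    (hasCompactSupport_bump hr.le) hf x) (hi.smul_const v), integral_smul_const, h1, smear]

theorem norm_integral_bump_smul_le {r : ℝ} (hr : 0 < r) {f : Plane → E} (x : Plane)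
    (hf : LocallyIntegrable f) :
    ‖∫ y, bump r (x - y) • f y‖ ≤ r ^ 6 * ∫ y in Metric.closedBall x r, ‖f y‖ := by
  have hz (y) (hy : y ∉ Metric.closedBall x r) : bump r (x - y) = 0 :=
    bump_eq_zero hr.le (by rw [← dist_eq_norm, dist_comm]; exact (not_le.1 hy).le)
  rw [← setIntegral_eq_integral_of_forall_compl_eq_zero
    (s := Metric.closedBall x r) (fun y hy => by rw [hz y hy, zero_smul]), ← integral_const_mul]
  refine norm_integral_le_of_norm_le
    ((hf.integrableOn_isCompact (isCompact_closedBall x r)).norm.const_mul _)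
    (Eventually.of_forall fun y => ?_)
  rw [norm_smul, Real.norm_of_nonneg (bump_nonneg _ _)]
  gcongr
  exact bump_le _ _

theorem volume_real_closedBall (x : Plane) {r : ℝ} (hr : 0 ≤ r) :
    volume.real (Metric.closedBall x r) = Real.pi * r ^ 2 := by
  rw [Measure.real, EuclideanSpace.volume_closedBall_fin_two]
  simp [ENNReal.toReal_ofReal hr, ENNReal.toReal_ofReal Real.pi_pos.le, mul_comm]

/-- The normalized mollifications converge to the function almost everywhere. -/
theorem ae_tendsto_smear [CompleteSpace E] {f : Plane → E} (hf : LocallyIntegrable f) :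
    ∀ᵐ x, Tendsto (fun r => (bumpMass * r ^ 8)⁻¹ • smear r f x) (𝓝[>] 0) (𝓝 (f x)) := by
  filter_upwards [IsUnifLocDoublingMeasure.ae_tendsto_average_norm_sub volume hf 1] with x hx
  have h1 := hx (l := 𝓝[>] (0 : ℝ)) (fun _ => x) id tendsto_id
    (by filter_upwards [self_mem_nhdsWithin] with r hr
        simpa using le_of_lt hr)
  rw [tendsto_iff_norm_sub_tendsto_zero]
  have h2 : Tendsto (fun r : ℝ => bumpMass⁻¹ * Real.pi *
      ⨍ y in Metric.closedBall x r, ‖f y - f x‖) (𝓝[>] 0) (𝓝 0) := by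
    simpa using h1.const_mul (bumpMass⁻¹ * Real.pi)
  refine squeeze_zero' (Eventually.of_forall fun _ => norm_nonneg _) ?_ h2
  filter_upwards [self_mem_nhdsWithin] with r hr
  have hr : 0 < r := hr
  have hm : 0 < bumpMass * r ^ 8 := mul_pos bumpMass_pos (by positivity)
  have h3 : (bumpMass * r ^ 8)⁻¹ • smear r f x - f x =
      (bumpMass * r ^ 8)⁻¹ • (smear r f x - (bumpMass * r ^ 8) • f x) := by
    rw [smul_sub, inv_smul_smul₀ hm.ne']
  rw [h3, smear_sub_smul hr hf, norm_smul, Real.norm_of_nonneg (by positivity),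
    setAverage_eq, volume_real_closedBall x hr.le, smul_eq_mul]
  have h4 := norm_integral_bump_smul_le hr x (hf.sub (locallyIntegrable_const (f x)))
  calc _ ≤ (bumpMass * r ^ 8)⁻¹ * (r ^ 6 * ∫ y in Metric.closedBall x r, ‖f y - f x‖) := by
        gcongr; exact h4
    _ = _ := by
        have := bumpMass_pos.ne'
        have := Real.pi_ne_zero
        field_simp

end

/-- The mean value property (and with it, regularity) for weakly harmonic fields. -/
theorem ae_smear_eq_smul {Ω : Set Plane} (hΩ : IsOpen Ω) {u : Plane → Plane}
    (hsol : WeaklySolenoidal Ω u) (hirr : WeaklyIrrotational Ω u)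
    (hu : LocallyIntegrable (Ω.indicator u)) :
    ∀ᵐ x, ∀ R > 0, Metric.closedBall x R ⊆ Ω →
      smear R (Ω.indicator u) x = (bumpMass * R ^ 8) • u x := by
  filter_upwards [ae_tendsto_smear hu] with x hx R hR hxR
  rw [Set.indicator_of_mem (hxR (Metric.mem_closedBall_self hR.le))] at hx
  have hc : Tendsto (fun r => (bumpMass * r ^ 8)⁻¹ • smear r (Ω.indicator u) x) (𝓝[>] 0)
      (𝓝 ((bumpMass * R ^ 8)⁻¹ • smear R (Ω.indicator u) x)) := by
    refine tendsto_const_nhds.congr' ?_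
    filter_upwards [Ioo_mem_nhdsGT hR] with r hr
    rw [mul_inv, mul_inv, mul_smul, mul_smul, smear_scaling hΩ hsol hirr hu hr.1 hr.2.le hxR]
  rw [tendsto_nhds_unique hx hc, smul_inv_smul₀ (mul_pos bumpMass_pos (by positivity)).ne']

/-! ### Limits of gradients are gradients -/

/-- `u` is the limit in `L²(Ω)` of gradients of Neumann test functions. -/
def InGradientClosure (Ω : Set Plane) (u : Plane → Plane) : Prop :=
  ∀ ε : ℝ, 0 < ε → ∃ ψ : Plane → ℝ, IsNeumannTest Ω ψ ∧
    eLpNorm (fun x => gradient ψ x - u x) 2 (volume.restrict Ω) ≤ ENNReal.ofReal ε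

theorem divergence_smul_const {h : Plane → ℝ} {x : Plane} (hh : DifferentiableAt ℝ h x)
    (e : Plane) : divergence (fun y => h y • e) x = fderiv ℝ h x e := by
  rw [divergence_smul hh (differentiableAt_const e), divergence_const, mul_zero, add_zero,
    inner_gradient_left]

theorem tsupport_bump_sub_subset {r : ℝ} (hr : 0 ≤ r) (x : Plane) :
    tsupport (fun y => bump r (x - y)) ⊆ Metric.closedBall x r := by
  refine closure_minimal (fun y hy => ?_) Metric.isClosed_closedBall
  by_contra hc
  exact hy (bump_eq_zero hr (by rw [← dist_eq_norm, dist_comm]; exact (not_le.1 hc).le))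

theorem hasCompactSupport_bump_sub {r : ℝ} (hr : 0 ≤ r) (x : Plane) :
    HasCompactSupport (fun y => bump r (x - y)) :=
  (isCompact_closedBall x r).of_isClosed_subset (isClosed_tsupport _)
    (tsupport_bump_sub_subset hr x)

theorem contDiff_bump_sub (r : ℝ) (x : Plane) : ContDiff ℝ 2 (fun y => bump r (x - y)) :=
  (contDiff_bump r).comp (contDiff_const.sub contDiff_id)

theorem fderiv_bump_sub (r : ℝ) (x y : Plane) :
    fderiv ℝ (fun y => bump r (x - y)) y = - fderiv ℝ (bump r) (x - y) := by
  have h := (((contDiff_bump r).differentiable two_ne_zero (x - y)).hasFDerivAt).comp y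
    ((hasFDerivAt_id y).const_sub x)
  have h2 : HasFDerivAt (fun y => bump r (x - y))
    ((fderiv ℝ (bump r) (x - y)).comp (-ContinuousLinearMap.id ℝ Plane)) y := h
  rw [h2.fderiv]
  ext v
  simp

theorem hasGradientAt_smear {Ω : Set Plane} (hΩ : IsOpen Ω) {ψ : Plane → ℝ}
    (hψ : IsNeumannTest Ω ψ) {r : ℝ} (hr : 0 < r) {x : Plane} (hx : Metric.closedBall x r ⊆ Ω) :
    HasGradientAt (smear r (Ω.indicator ψ)) (smear r (Ω.indicator (gradient ψ)) x) x := by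
  have hl := locallyIntegrable_indicator hΩ hψ.memLp
  have hd : DifferentiableAt ℝ (smear r (Ω.indicator ψ)) x :=
    (contDiff_smear hr.le hl).differentiable two_ne_zero x
  convert hd.hasGradientAt
  refine ext_inner_right ℝ fun e => ?_
  rw [inner_gradient_left, fderiv_smear_apply hr.le hl, inner_smear_indicator hΩ
    (locallyIntegrable_indicator hΩ hψ.memLp_gradient) hr.le]
  have hY : ContDiff ℝ 1 fun y => bump r (x - y) • e :=
    ((contDiff_bump_sub r x).of_le (by norm_num)).smul contDiff_const
  have hsub : tsupport (fun y => bump r (x - y) • e) ⊆ tsupport (fun y => bump r (x - y)) :=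
    closure_mono fun y hy => by
      contrapose! hy
      simp [Function.notMem_support.1 hy]
  have hts := hsub.trans (tsupport_bump_sub_subset hr.le x)
  have h1 := integral_inner_gradient_eq_neg hΩ hψ.contDiffOn hY
    ((isCompact_closedBall x r).of_isClosed_subset (isClosed_tsupport _) hts) (hts.trans hx)
  rw [← integral_neg] at h1
  convert h1 using 1
  · congr 1
    ext y
    rw [real_inner_smul_right, ← bump_neg, neg_sub, mul_comm]
  · rw [← integral_indicator hΩ.measurableSet]
    congr 1
    ext y
    by_cases hy : y ∈ Ω
    · rw [Set.indicator_of_mem hy, Set.indicator_of_mem hy, divergence_smul_const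
        ((contDiff_bump_sub r x).differentiable two_ne_zero y), fderiv_bump_sub]
      simp [mul_comm]
    · simp [hy]

/-- The Cauchy-Schwarz inequality on a disc. -/
theorem setIntegral_norm_le {E : Type*} [NormedAddCommGroup E] {f : Plane → E} {x : Plane} {r : ℝ}
    (hr : 0 ≤ r) (hf : MemLp f 2 (volume.restrict (Metric.closedBall x r))) :
    ∫ y in Metric.closedBall x r, ‖f y‖ ≤ √(Real.pi * r ^ 2) *
      (eLpNorm f 2 (volume.restrict (Metric.closedBall x r))).toReal := by
  have h := eLpNorm_le_eLpNorm_mul_rpow_measure_univ (p := 1) (q := 2) (by norm_num)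
    hf.aestronglyMeasurable
  have hfin : volume (Metric.closedBall x r) ≠ ⊤ := (isCompact_closedBall x r).measure_lt_top.ne
  rw [eLpNorm_one_eq_lintegral_enorm, Measure.restrict_apply_univ] at h
  rw [integral_norm_eq_lintegral_enorm hf.aestronglyMeasurable]
  refine (ENNReal.toReal_mono (ENNReal.mul_ne_top hf.eLpNorm_ne_top
    (ENNReal.rpow_ne_top_of_nonneg (by norm_num) hfin)) h).trans_eq ?_
  rw [ENNReal.toReal_mul, ← ENNReal.toReal_rpow, ← Measure.real, volume_real_closedBall x hr,
    Real.sqrt_eq_rpow, mul_comm]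
  norm_num

theorem norm_smear_indicator_le {Ω : Set Plane} (hΩ : IsOpen Ω) {w : Plane → Plane}
    (hw : MemLp w 2 (volume.restrict Ω)) {r : ℝ} (hr : 0 < r) {x : Plane}
    (hx : Metric.closedBall x r ⊆ Ω) :
    ‖smear r (Ω.indicator w) x‖ ≤ r ^ 6 * (√(Real.pi * r ^ 2) *
      (eLpNorm w 2 (volume.restrict (Metric.closedBall x r))).toReal) := by
  refine (norm_integral_bump_smul_le hr x (locallyIntegrable_indicator hΩ hw)).trans ?_
  gcongr
  refine le_trans (le_of_eq ?_) (setIntegral_norm_le hr.le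
    (hw.mono_measure (Measure.restrict_mono_set _ hx)))
  exact setIntegral_congr_fun Metric.isClosed_closedBall.measurableSet fun y hy => by
    simp [Set.indicator_of_mem (hx hy)]

/-- If the gradients of functions converge locally uniformly to a field, then the field is the
gradient of a single-valued function. The additive constants are fixed separately on each class of
the equivalence relation "the differences of the values at both points converge". -/
theorem exists_hasGradientAt_of_tendsto {Ω : Set Plane} {f : ℕ → Plane → ℝ}
    {v : ℕ → Plane → Plane} {u : Plane → Plane}
    (h : ∀ x ∈ Ω, ∃ δ > 0, TendstoUniformlyOn v u atTop (Metric.ball x δ) ∧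
      ∀ᶠ n in atTop, ∀ y ∈ Metric.ball x δ, HasGradientAt (f n) (v n y) y) :
    ∃ θ : Plane → ℝ, ∀ x ∈ Ω, HasGradientAt θ (u x) x := by
  let S : Setoid Plane :=
    { r := fun x y => ∃ l, Tendsto (fun n => f n x - f n y) atTop (𝓝 l)
      iseqv :=
        { refl := fun x => ⟨0, by simp⟩
          symm := fun {x y} ⟨l, hl⟩ => ⟨-l, by simpa using hl.neg⟩
          trans := fun {x y z} ⟨l, hl⟩ ⟨m, hm⟩ => ⟨l + m, by simpa using hl.add hm⟩ } }
  let rep : Plane → Plane := fun x => (Quotient.mk S x).out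
  have hrep (x) : ∃ l, Tendsto (fun n => f n x - f n (rep x)) atTop (𝓝 l) :=
    S.symm (Quotient.mk_out (s := S) x)
  choose θ hθ using hrep
  refine ⟨θ, fun x hx => ?_⟩
  obtain ⟨δ, hδ, hv, hf⟩ := h x hx
  have hdual : TendstoUniformlyOn (fun n y => InnerProductSpace.toDual ℝ Plane (v n y))
      (fun y => InnerProductSpace.toDual ℝ Plane (u y)) atTop (Metric.ball x δ) :=
    (InnerProductSpace.toDual ℝ Plane).isometry.uniformContinuous.comp_tendstoUniformlyOn hv
  obtain ⟨N, hN⟩ := eventually_atTop.1 hf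
  have hclose (y) (hy : y ∈ Metric.ball x δ) : S.r y x := by
    have hc := cauchy_map_of_uniformCauchySeqOn_fderiv (𝕜 := ℝ) (l := atTop)
      (f := fun n z => f (n + N) z - f (n + N) x)
      (f' := fun n z => InnerProductSpace.toDual ℝ Plane (v (n + N) z))
      Metric.isOpen_ball (convex_ball x δ).isPreconnected
      (fun s hs => by
        have := (tendsto_add_atTop_nat N).prodMap (tendsto_add_atTop_nat N)
        rw [prod_atTop_atTop_eq] at this
        have h3 := hdual.uniformCauchySeqOn s hs
        rw [prod_atTop_atTop_eq] at h3 ⊢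
        exact this.eventually h3)
      (fun n z hz => (hN (n + N) (Nat.le_add_left _ _) z hz).hasFDerivAt.sub_const _)
      (Metric.mem_ball_self hδ) hy (by
        simp only [sub_self]
        exact tendsto_const_nhds.cauchy_map)
    obtain ⟨l, hl⟩ := cauchy_map_iff_exists_tendsto.1 hc
    exact ⟨l, (tendsto_add_atTop_iff_nat N).1 hl⟩
  have hreq (y) (hy : y ∈ Metric.ball x δ) : rep y = rep x := by
    have : Quotient.mk S y = Quotient.mk S x := Quotient.sound (hclose y hy)
    simp only [rep, this]
  rw [hasGradientAt_iff_hasFDerivAt]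
  refine hasFDerivAt_of_tendstoUniformlyOnFilter (l := atTop)
    (f := fun n y => f n y - f n (rep x))
    (f' := fun n y => InnerProductSpace.toDual ℝ Plane (v n y))
    (g' := fun y => InnerProductSpace.toDual ℝ Plane (u y)) ?_ ?_ ?_
  · exact (tendstoUniformlyOn_iff_tendstoUniformlyOnFilter.1 hdual).mono_right
      (le_principal_iff.2 (Metric.ball_mem_nhds x hδ))
  · filter_upwards [hf.prod_mk (Metric.ball_mem_nhds x hδ)] with p hp
    exact (hp.1 p.2 hp.2).hasFDerivAt.sub_const _
  · filter_upwards [Metric.ball_mem_nhds x hδ] with y hy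
    rw [← hreq y hy]
    exact hθ y

/-- A continuous field in the `L²`-closure of the gradients is a gradient: the mollified
approximating potentials have locally uniformly convergent gradients. -/
theorem InGradientClosure.exists_hasGradientAt {Ω : Set Plane} (hΩ : IsOpen Ω) {u : Plane → Plane}
    (hu : InGradientClosure Ω u) (hu2 : MemLp u 2 (volume.restrict Ω)) (huc : ContinuousOn u Ω) :
    ∃ θ : Plane → ℝ, ∀ x ∈ Ω, HasGradientAt θ (u x) x := by
  set r : ℕ → ℝ := fun n => 1 / ((n : ℝ) + 1) with hr
  have hr0 (n) : 0 < r n := Nat.one_div_pos_of_nat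
  have hrt : Tendsto r atTop (𝓝 0) := tendsto_one_div_add_atTop_nhds_zero_nat
  set m : ℕ → ℝ := fun n => bumpMass * r n ^ 8 with hm
  have hm0 (n) : 0 < m n := mul_pos bumpMass_pos (pow_pos (hr0 n) 8)
  have hK (n) : 0 < (r n) ^ 6 * √(Real.pi * r n ^ 2) := by
    have := hr0 n
    have := Real.pi_pos
    positivity
  have hex (n : ℕ) := hu (m n * r n / ((r n) ^ 6 * √(Real.pi * r n ^ 2)))
    (div_pos (mul_pos (hm0 n) (hr0 n)) (hK n))
  choose ψ hψ hψu using hex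
  refine exists_hasGradientAt_of_tendsto
    (f := fun n x => (m n)⁻¹ • smear (r n) (Ω.indicator (ψ n)) x)
    (v := fun n x => (m n)⁻¹ • smear (r n) (Ω.indicator (gradient (ψ n))) x) fun x hx => ?_
  obtain ⟨δ', hδ', hball⟩ := Metric.isOpen_iff.1 hΩ x hx
  set δ := δ' / 3 with hδdef
  have hδ : 0 < δ := by positivity
  have hsub : Metric.closedBall x (2 * δ) ⊆ Ω :=
    (Metric.closedBall_subset_ball (by linarith)).trans hball
  have hsmall : ∀ᶠ n in atTop, r n < δ := hrt.eventually (gt_mem_nhds hδ)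
  have hin (n) (hn : r n < δ) (y) (hy : y ∈ Metric.ball x δ) :
      Metric.closedBall y (r n) ⊆ Metric.closedBall x (2 * δ) := by
    refine Metric.closedBall_subset_closedBall' ?_
    linarith [Metric.mem_ball.1 hy]
  refine ⟨δ, hδ, ?_, ?_⟩
  · rw [Metric.tendstoUniformlyOn_iff]
    intro ε hε
    have huc' := (isCompact_closedBall x (2 * δ)).uniformContinuousOn_of_continuous
      (huc.mono hsub)
    obtain ⟨η, hη, hη'⟩ := Metric.uniformContinuousOn_iff_le.1 huc' (ε / 3) (by positivity)
    filter_upwards [hsmall, hrt.eventually (gt_mem_nhds hη),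
      hrt.eventually (gt_mem_nhds (show 0 < ε / 3 by positivity))] with n h1 h2 h3 y hy
    have hyΩ := (hin n h1 y hy).trans hsub
    have hy2 : y ∈ Metric.closedBall x (2 * δ) :=
      hin n h1 y hy (Metric.mem_closedBall_self (hr0 n).le)
    have hgl := locallyIntegrable_indicator hΩ (hψ n).memLp_gradient
    have hul := locallyIntegrable_indicator hΩ hu2
    have hwm : MemLp (fun x => gradient (ψ n) x - u x) 2 (volume.restrict Ω) :=
      (hψ n).memLp_gradient.sub hu2
    have hsplit : smear (r n) (Ω.indicator (gradient (ψ n))) y =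
        smear (r n) (Ω.indicator fun x => gradient (ψ n) x - u x) y +
          smear (r n) (Ω.indicator u) y := by
      simp only [smear]
      rw [← integral_add (integrable_smul_of_locallyIntegrable (contDiff_bump _).continuous
        (hasCompactSupport_bump (hr0 n).le) (locallyIntegrable_indicator hΩ hwm) y)
        (integrable_smul_of_locallyIntegrable (contDiff_bump _).continuous
        (hasCompactSupport_bump (hr0 n).le) hul y)]
      congr 1
      ext1 z
      rw [← smul_add]
      by_cases hz : z ∈ Ω <;> simp [hz]
    have hA : ‖smear (r n) (Ω.indicator fun x => gradient (ψ n) x - u x) y‖ ≤ m n * r n := by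
      refine (norm_smear_indicator_le hΩ hwm (hr0 n) hyΩ).trans ?_
      have h4 : (eLpNorm (fun x => gradient (ψ n) x - u x) 2
          (volume.restrict (Metric.closedBall y (r n)))).toReal ≤
          m n * r n / ((r n) ^ 6 * √(Real.pi * r n ^ 2)) := by
        refine ENNReal.toReal_le_of_le_ofReal (div_pos (mul_pos (hm0 n) (hr0 n)) (hK n)).le ?_
        exact (eLpNorm_mono_measure _ (Measure.restrict_mono_set _ hyΩ)).trans (hψu n)
      rw [← mul_assoc]
      refine (mul_le_mul_of_nonneg_left h4 (hK n).le).trans_eq ?_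
      rw [mul_div_cancel₀ _ (hK n).ne']
    have hB : ‖smear (r n) (Ω.indicator u) y - m n • u y‖ ≤ m n * (ε / 3) := by
      rw [hm]
      rw [smear_sub_smul (hr0 n) hul]
      have hi : Integrable fun z => bump (r n) (y - z) := by
        have := ((contDiff_bump (r n)).continuous.integrable_of_hasCompactSupport
          (hasCompactSupport_bump (hr0 n).le) (μ := volume)).comp_sub_left y
        exact this
      refine (norm_integral_le_of_norm_le (hi.mul_const (ε / 3))
        (Eventually.of_forall fun z => ?_)).trans_eq ?_
      · rw [norm_smul, Real.norm_of_nonneg (bump_nonneg _ _)]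
        by_cases hz : z ∈ Metric.closedBall y (r n)
        · refine mul_le_mul_of_nonneg_left ?_ (bump_nonneg _ _)
          rw [Set.indicator_of_mem (hyΩ hz), ← dist_eq_norm]
          exact hη' z (hin n h1 y hy hz) y hy2 ((Metric.mem_closedBall.1 hz).trans h2.le)
        · rw [bump_eq_zero (hr0 n).le, zero_mul, zero_mul]
          rw [← dist_eq_norm, dist_comm]
          exact (not_le.1 hz).le
      · rw [integral_mul_const, integral_sub_left_eq_self (bump (r n)) volume y,
          integral_bump (hr0 n)]
    rw [dist_comm, dist_eq_norm]
    have heq : (m n)⁻¹ • smear (r n) (Ω.indicator (gradient (ψ n))) y - u y =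
        (m n)⁻¹ • (smear (r n) (Ω.indicator fun x => gradient (ψ n) x - u x) y +
          (smear (r n) (Ω.indicator u) y - m n • u y)) := by
      rw [hsplit, ← add_sub_assoc, smul_sub, inv_smul_smul₀ (hm0 n).ne']
    rw [heq, norm_smul, norm_inv, Real.norm_of_nonneg (hm0 n).le]
    have h5 := (norm_add_le _ _).trans (add_le_add hA hB)
    calc _ ≤ (m n)⁻¹ * (m n * r n + m n * (ε / 3)) := by
          have := (hm0 n).le
          gcongr
      _ = r n + ε / 3 := by rw [← mul_add, inv_mul_cancel_left₀ (hm0 n).ne']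
      _ < ε := by linarith
  · filter_upwards [hsmall] with n hn y hy
    have h1 := hasGradientAt_smear hΩ (hψ n) (hr0 n) ((hin n hn y hy).trans hsub)
    rw [hasGradientAt_iff_hasFDerivAt] at h1 ⊢
    have h2 := h1.const_smul (m n)⁻¹
    rw [← map_smul] at h2
    exact h2

/-! ### Cutoff functions and the flux of the given flow -/

theorem isNeumannTest_of_hasCompactSupport (Ω : Set Plane) {g : Plane → ℝ} (hg : ContDiff ℝ 1 g)
    (hc : HasCompactSupport g) : IsNeumannTest Ω g where
  contDiffOn := hg.contDiffOn
  memLp := (hg.continuous.memLp_of_hasCompactSupport hc).restrict Ω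
  memLp_gradient := ((contDiff_gradient (n := 0)
    (by simpa using hg)).continuous.memLp_of_hasCompactSupport
      (hasCompactSupport_gradient hc)).restrict Ω
  bounded_support := by
    obtain ⟨R, hR⟩ := hc.isCompact.isBounded.subset_closedBall 0
    refine ⟨R, fun x _ hx => ?_⟩
    by_contra h
    have := hR (subset_tsupport g h)
    rw [mem_closedBall_zero_iff] at this
    linarith

theorem integrableOn_inner {Ω : Set Plane} {u v : Plane → Plane}
    (hu : MemLp u 2 (volume.restrict Ω)) (hv : MemLp v 2 (volume.restrict Ω)) :
    IntegrableOn (fun x => inner ℝ (u x) (v x)) Ω :=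
  (hu.norm.integrable_mul hv.norm).mono' (hu.1.inner hv.1)
    (Eventually.of_forall fun x => norm_inner_le_norm (𝕜 := ℝ) (u x) (v x))

/-- A function with zero derivative near a preconnected set is constant on that set. -/
theorem IsPreconnected.eq_of_fderiv_eq_zero {g : Plane → ℝ} (hg : Differentiable ℝ g)
    {U s : Set Plane} (hU : IsOpen U) (h0 : ∀ x ∈ U, fderiv ℝ g x = 0) (hs : IsPreconnected s)
    (hsU : s ⊆ U) {x y : Plane} (hx : x ∈ s) (hy : y ∈ s) : g x = g y :=
  (hU.connectedComponentIn (x := x)).is_const_of_fderiv_eq_zero (𝕜 := ℝ)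
    isPreconnected_connectedComponentIn
    hg.differentiableOn (fun z hz => h0 z (connectedComponentIn_subset U x hz))
    (mem_connectedComponentIn (hsU hx)) (hs.subset_connectedComponentIn hx hsU hy)

/-- A flow on `D` is orthogonal to gradients that are compactly supported in `D`, even if their
potentials do not vanish on the bodies: on each body such a potential is constant, and the constant
is zero for unbounded bodies. -/
theorem IsFlow.integral_inner_gradient_eq_zero {N : ℕ} {B : Fin N → Set Plane}
    (hBclosed : ∀ i, IsClosed (B i)) (hBconn : ∀ i, IsConnected (B i))
    (hBdisj : Pairwise fun i j => Disjoint (B i) (B j))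
    {D : Set Plane} (hD : D = (⋃ i, B i)ᶜ) {V : Plane → Plane} (hV : ContDiff ℝ 1 V)
    (hvol : ∀ i, Bornology.IsBounded (B i) → ∫ x in B i, divergence V x = 0)
    {φ : Plane → ℝ} (hφ : IsFlow D V φ) {g : Plane → ℝ} (hg : ContDiff ℝ 1 g)
    (hc : HasCompactSupport g) (hgD : tsupport (fderiv ℝ g) ⊆ D) :
    ∫ x in D, inner ℝ (gradient φ x) (gradient g x) = 0 := by
  have hDmeas : MeasurableSet D := by
    rw [hD]; exact (MeasurableSet.iUnion fun i => (hBclosed i).measurableSet).compl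
  have htest := isNeumannTest_of_hasCompactSupport D hg hc
  have h1 := hφ.noFlux g htest ⟨∅, isOpen_empty, by simp, by simp⟩
  set Z : Plane → Plane := fun x => g x • V x with hZ
  have hZd : ContDiff ℝ 1 Z := hg.smul hV
  have hZc : HasCompactSupport Z := hc.of_isClosed_subset (isClosed_tsupport _) <|
    closure_mono fun x hx => by
      contrapose! hx
      simp [hZ, Function.notMem_support.1 hx]
  have hdivZ (x) : divergence Z x = inner ℝ (gradient g x) (V x) + g x * divergence V x :=
    divergence_smul (hg.differentiable one_ne_zero x) (hV.differentiable one_ne_zero x)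
  have hZi : Integrable (divergence Z) :=
    (continuous_divergence hZd).integrable_of_hasCompactSupport (hasCompactSupport_divergence hZc)
  have hsplit (x) : inner ℝ (gradient φ x - V x) (gradient g x) - g x * divergence V x =
      inner ℝ (gradient φ x) (gradient g x) - divergence Z x := by
    rw [hdivZ, inner_sub_left, real_inner_comm (V x)]; ring
  simp only [hsplit] at h1
  rw [integral_sub (integrableOn_inner hφ.potential.finite_energy htest.memLp_gradient)
    hZi.integrableOn, sub_eq_zero] at h1
  rw [h1]
  have h2 := integral_divergence_eq_zero hZd hZc
  rw [← integral_add_compl hDmeas hZi] at h2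
  have hconst (i) : ∃ c, (∀ x ∈ B i, g x = c) ∧ (¬ Bornology.IsBounded (B i) → c = 0) := by
    obtain ⟨x₀, hx₀⟩ := (hBconn i).nonempty
    have heq : ∀ x ∈ B i, g x = g x₀ := fun x hx =>
      (hBconn i).isPreconnected.eq_of_fderiv_eq_zero (hg.differentiable one_ne_zero)
        (isClosed_tsupport (fderiv ℝ g)).isOpen_compl
        (fun y hy => image_eq_zero_of_notMem_tsupport hy)
        (fun y hy hy' => by
          have := hgD hy'
          rw [hD] at this
          exact this (Set.mem_iUnion_of_mem i hy)) hx hx₀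
    refine ⟨g x₀, heq, fun hunb => ?_⟩
    by_contra hne
    refine hunb (hc.isCompact.isBounded.subset fun x hx => subset_tsupport g ?_)
    rw [Function.mem_support, heq x hx]
    exact hne
  have hgrad (i) (x) (hx : x ∈ B i) : gradient g x = 0 := by
    have : fderiv ℝ g x = 0 := image_eq_zero_of_notMem_tsupport fun h => by
      have := hgD h
      rw [hD] at this
      exact this (Set.mem_iUnion_of_mem i hx)
    simp [gradient, this]
  have hB (i) : ∫ x in B i, divergence Z x = 0 := by
    obtain ⟨c, hgc, hunb⟩ := hconst i
    have : ∫ x in B i, divergence Z x = ∫ x in B i, c * divergence V x := by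
      apply setIntegral_congr_fun (hBclosed i).measurableSet
      intro x hx
      simp only
      rw [hdivZ, hgrad i x hx, hgc x hx, inner_zero_left, zero_add]
    rw [this, integral_const_mul]
    by_cases hb : Bornology.IsBounded (B i)
    · rw [hvol i hb, mul_zero]
    · rw [hunb hb, zero_mul]
  have hcompl : ∫ x in Dᶜ, divergence Z x = 0 := by
    rw [hD, compl_compl, integral_iUnion_fintype (fun i => (hBclosed i).measurableSet) hBdisj
      fun i => hZi.integrableOn]
    simp [hB]
  rw [hcompl, add_zero] at h2
  exact h2

/-- Smooth cutoff functions for compact sets. -/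
theorem exists_contDiff_one_nhds {K G : Set Plane} (hK : IsCompact K) (hG : IsOpen G)
    (hKG : K ⊆ G) : ∃ χ : Plane → ℝ, ContDiff ℝ 2 χ ∧ HasCompactSupport χ ∧ tsupport χ ⊆ G ∧
      (∀ x ∈ K, χ =ᶠ[𝓝 x] fun _ => 1) ∧ ∀ x, χ x ∈ Set.Icc 0 1 := by
  obtain ⟨L, hL, hKL, hLG⟩ := exists_compact_between hK hG hKG
  obtain ⟨f, hf1, hf0, hf⟩ := exists_contMDiffMap_one_nhds_of_subset_interior
    (n := 2) (modelWithCornersSelf ℝ Plane) hK.isClosed hKL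
  have hts : tsupport f ⊆ L := closure_minimal (fun x hx => by
    by_contra h
    exact hx (hf0 x h)) hL.isClosed
  refine ⟨f, f.contMDiff.contDiff, hL.of_isClosed_subset (isClosed_tsupport _) hts,
    hts.trans hLG, fun x hx => hf1.filter_mono (nhds_le_nhdsSet hx), hf⟩

theorem isPreconnected_lt_norm (R : ℝ) : IsPreconnected {x : Plane | R < ‖x‖} := by
  have hrank : 1 < Module.rank ℝ Plane := by
    rw [← Module.finrank_eq_rank, finrank_euclideanSpace]
    simp
  rcases lt_or_ge R 0 with hR | hR
  · have : {x : Plane | R < ‖x‖} = Set.univ := by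
      ext x; simpa using hR.trans_le (norm_nonneg x)
    rw [this]
    exact isPreconnected_univ
  · have : {x : Plane | R < ‖x‖} =
        (fun p : ℝ × Plane => p.1 • p.2) '' (Set.Ioi R ×ˢ Metric.sphere 0 1) := by
      ext x
      constructor
      · intro hx
        have hx0 : 0 < ‖x‖ := hR.trans_lt hx
        refine ⟨(‖x‖, ‖x‖⁻¹ • x), ⟨hx, ?_⟩, ?_⟩
        · simp [norm_smul, hx0.ne']
        · simp [smul_smul, hx0.ne']
      · rintro ⟨⟨t, y⟩, ⟨ht, hy⟩, rfl⟩
        simp only [Set.mem_Ioi, mem_sphere_iff_norm, sub_zero] at ht hy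
        simp [norm_smul, hy, abs_of_pos (hR.trans_lt ht), ht]
    rw [this]
    exact (isPreconnected_Ioi.prod (isPreconnected_sphere hrank 0 1)).image _ (by fun_prop)

theorem isBounded_or_isBounded_compl {F : Set Plane} (hF : IsClosed F)
    (hb : Bornology.IsBounded (frontier F)) :
    Bornology.IsBounded F ∨ Bornology.IsBounded Fᶜ := by
  obtain ⟨R, hR⟩ := hb.subset_closedBall 0
  have hsub : {x : Plane | R < ‖x‖} ⊆ interior F ∪ Fᶜ := by
    intro x hx
    by_contra h
    simp only [Set.mem_union, not_or, Set.mem_compl_iff, not_not] at h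
    have : x ∈ frontier F := by rw [hF.frontier_eq]; exact ⟨h.2, h.1⟩
    have := hR this
    rw [mem_closedBall_zero_iff] at this
    exact absurd hx (not_lt.2 this)
  have hball (G : Set Plane) (hG : {x : Plane | R < ‖x‖} ⊆ Gᶜ) : Bornology.IsBounded G := by
    refine (Metric.isBounded_closedBall (x := (0 : Plane)) (r := R)).subset fun x hx => ?_
    by_contra h
    exact hG (by simpa using h) hx
  rcases (isPreconnected_lt_norm R).subset_or_subset isOpen_interior hF.isOpen_compl
    (Set.disjoint_left.2 fun x hx hx' => hx' (interior_subset hx)) hsub with h | h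
  · right
    exact hball _ (by rw [compl_compl]; exact h.trans interior_subset)
  · exact Or.inl (hball _ h)

/-- Since one of the two boundaries is bounded, there is a cutoff function between the body `C` and
the boundary of `D` whose gradient has compact support. -/
theorem exists_cutoff {D C : Set Plane} (hD : IsOpen D) (hC : IsClosed C) (hCD : C ⊆ D)
    (hbdd : Bornology.IsBounded (frontier D) ∨ Bornology.IsBounded (frontier C)) :
    ∃ χ : Plane → ℝ, ContDiff ℝ 2 χ ∧ HasCompactSupport (fderiv ℝ χ) ∧
      (∀ x ∈ C, χ =ᶠ[𝓝 x] fun _ => 1) ∧ (∀ x ∉ D, χ =ᶠ[𝓝 x] fun _ => 0) ∧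
      ∀ x, χ x ∈ Set.Icc 0 1 := by
  have hcpt : IsCompact C ∨ IsCompact Dᶜ := by
    have hCb (h : Bornology.IsBounded C) : IsCompact C :=
      Metric.isCompact_of_isClosed_isBounded hC h
    have hDb (h : Bornology.IsBounded Dᶜ) : IsCompact Dᶜ :=
      Metric.isCompact_of_isClosed_isBounded hD.isClosed_compl h
    rcases hbdd with h | h
    · rw [← frontier_compl] at h
      rcases isBounded_or_isBounded_compl hD.isClosed_compl h with h | h
      · exact Or.inr (hDb h)
      · rw [compl_compl] at h
        exact Or.inl (hCb (h.subset hCD))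
    · rcases isBounded_or_isBounded_compl hC h with h | h
      · exact Or.inl (hCb h)
      · exact Or.inr (hDb (h.subset (Set.compl_subset_compl.2 hCD)))
  rcases hcpt with hK | hK
  · obtain ⟨χ, h1, h2, h3, h4, h5⟩ := exists_contDiff_one_nhds hK hD hCD
    exact ⟨χ, h1, h2.fderiv ℝ, h4, fun x hx =>
      notMem_tsupport_iff_eventuallyEq.1 fun h => hx (h3 h), h5⟩
  · obtain ⟨χ, h1, h2, h3, h4, h5⟩ := exists_contDiff_one_nhds hK hC.isOpen_compl
      (Set.compl_subset_compl.2 hCD)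
    refine ⟨fun x => 1 - χ x, contDiff_const.sub h1, ?_, fun x hx => ?_, fun x hx => ?_,
      fun x => ⟨by linarith [(h5 x).2], by linarith [(h5 x).1]⟩⟩
    · have : fderiv ℝ (fun x => 1 - χ x) = -fderiv ℝ χ := by
        ext1 x; simp [fderiv_const_sub]
      rw [this]
      exact (h2.fderiv ℝ).neg
    · filter_upwards [notMem_tsupport_iff_eventuallyEq.1 fun h => h3 h hx] with y hy
      simp [hy]
    · filter_upwards [h4 x hx] with y hy
      simp [hy]

/-! ### Orthogonal projection onto the gradients -/

section Projection

variable {Ω : Set Plane}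

theorem IsNeumannTest.differentiableAt (hΩ : IsOpen Ω) {ψ : Plane → ℝ} (h : IsNeumannTest Ω ψ)
    {x : Plane} (hx : x ∈ Ω) : DifferentiableAt ℝ ψ x :=
  (h.contDiffOn.contDiffAt (hΩ.mem_nhds hx)).differentiableAt one_ne_zero

theorem IsNeumannTest.add (hΩ : IsOpen Ω) {ψ₁ ψ₂ : Plane → ℝ} (h₁ : IsNeumannTest Ω ψ₁)
    (h₂ : IsNeumannTest Ω ψ₂) : IsNeumannTest Ω (fun x => ψ₁ x + ψ₂ x) where
  contDiffOn := h₁.contDiffOn.add h₂.contDiffOn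
  memLp := h₁.memLp.add h₂.memLp
  memLp_gradient := (h₁.memLp_gradient.add h₂.memLp_gradient).ae_eq <|
    (ae_restrict_mem hΩ.measurableSet).mono fun x hx =>
      (gradient_fun_add (h₁.differentiableAt hΩ hx) (h₂.differentiableAt hΩ hx)).symm
  bounded_support := by
    obtain ⟨R₁, hR₁⟩ := h₁.bounded_support
    obtain ⟨R₂, hR₂⟩ := h₂.bounded_support
    refine ⟨max R₁ R₂, fun x hx hR => ?_⟩
    rw [hR₁ x hx ((le_max_left _ _).trans_lt hR), hR₂ x hx ((le_max_right _ _).trans_lt hR),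
      add_zero]

theorem gradient_const_mul {ψ : Plane → ℝ} {x : Plane} (c : ℝ) (h : DifferentiableAt ℝ ψ x) :
    gradient (fun y => c * ψ y) x = c • gradient ψ x := by
  rw [gradient_fun_mul (differentiableAt_const c) h]
  simp

theorem IsNeumannTest.const_mul (hΩ : IsOpen Ω) {ψ : Plane → ℝ} (h : IsNeumannTest Ω ψ)
    (c : ℝ) : IsNeumannTest Ω (fun x => c * ψ x) where
  contDiffOn := contDiffOn_const.mul h.contDiffOn
  memLp := h.memLp.const_mul c
  memLp_gradient := (h.memLp_gradient.const_smul c).ae_eq <|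
    (ae_restrict_mem hΩ.measurableSet).mono fun x hx =>
      (gradient_const_mul c (h.differentiableAt hΩ hx)).symm
  bounded_support := by
    obtain ⟨R, hR⟩ := h.bounded_support
    exact ⟨R, fun x hx hR' => by rw [hR x hx hR', mul_zero]⟩

/-- The gradients of Neumann test functions, as a subspace of `L²(Ω)`. -/
def testGradients (hΩ : IsOpen Ω) : Submodule ℝ (Lp Plane 2 (volume.restrict Ω)) where
  carrier := {f | ∃ (ψ : Plane → ℝ) (h : IsNeumannTest Ω ψ), f = h.memLp_gradient.toLp}
  zero_mem' := by
    have h0 := isNeumannTest_of_hasCompactSupport Ω (g := fun _ => 0) contDiff_const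
      HasCompactSupport.zero
    refine ⟨_, h0, ?_⟩
    rw [eq_comm, Lp.eq_zero_iff_ae_eq_zero]
    exact h0.memLp_gradient.coeFn_toLp.trans
      (Eventually.of_forall fun x => gradient_fun_const x 0)
  add_mem' := by
    rintro _ _ ⟨ψ₁, h₁, rfl⟩ ⟨ψ₂, h₂, rfl⟩
    refine ⟨_, h₁.add hΩ h₂, ?_⟩
    rw [← MemLp.toLp_add, MemLp.toLp_eq_toLp_iff]
    exact (ae_restrict_mem hΩ.measurableSet).mono fun x hx =>
      (gradient_fun_add (h₁.differentiableAt hΩ hx) (h₂.differentiableAt hΩ hx)).symm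
  smul_mem' := by
    rintro c _ ⟨ψ, h, rfl⟩
    refine ⟨_, h.const_mul hΩ c, ?_⟩
    rw [← MemLp.toLp_const_smul, MemLp.toLp_eq_toLp_iff]
    exact (ae_restrict_mem hΩ.measurableSet).mono fun x hx =>
      (gradient_const_mul c (h.differentiableAt hΩ hx)).symm

theorem inGradientClosure_of_mem {hΩ : IsOpen Ω} {f : Lp Plane 2 (volume.restrict Ω)}
    (hf : f ∈ (testGradients hΩ).topologicalClosure) : InGradientClosure Ω f := by
  intro ε hε
  rw [← SetLike.mem_coe, Submodule.topologicalClosure_coe] at hf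
  obtain ⟨_, ⟨ψ, hψ, rfl⟩, hd⟩ := EMetric.mem_closure_iff.1 hf (ENNReal.ofReal ε) (by simpa)
  refine ⟨ψ, hψ, ?_⟩
  rw [edist_comm, Lp.edist_def] at hd
  refine le_trans (le_of_eq (eLpNorm_congr_ae ?_)) hd.le
  filter_upwards [hψ.memLp_gradient.coeFn_toLp] with x hx
  simp [hx]

theorem integral_inner_eq_inner_toLp {u v : Plane → Plane} (hu : MemLp u 2 (volume.restrict Ω))
    (hv : MemLp v 2 (volume.restrict Ω)) :
    ∫ x in Ω, inner ℝ (u x) (v x) = inner ℝ hu.toLp hv.toLp := by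
  rw [L2.inner_def]
  refine integral_congr_ae ?_
  filter_upwards [hu.coeFn_toLp, hv.coeFn_toLp] with x h1 h2
  rw [h1, h2]

/-- The orthogonal projection of a field onto the `L²`-closure of the gradients. -/
theorem exists_projection (hΩ : IsOpen Ω) {u : Plane → Plane}
    (hu : MemLp u 2 (volume.restrict Ω)) :
    ∃ v : Plane → Plane, MemLp v 2 (volume.restrict Ω) ∧ InGradientClosure Ω v ∧
      ∀ ψ, IsNeumannTest Ω ψ →
        ∫ x in Ω, inner ℝ (v x) (gradient ψ x) = ∫ x in Ω, inner ℝ (u x) (gradient ψ x) := by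
  set K := (testGradients hΩ).topologicalClosure
  set p := K.starProjection hu.toLp with hp
  have hpK : p ∈ K := K.starProjection_apply_mem _
  refine ⟨p, Lp.memLp p, inGradientClosure_of_mem hpK, fun ψ hψ => ?_⟩
  rw [integral_inner_eq_inner_toLp (Lp.memLp p) hψ.memLp_gradient,
    integral_inner_eq_inner_toLp hu hψ.memLp_gradient, Lp.toLp_coeFn, ← sub_eq_zero,
    ← inner_sub_left, ← neg_sub, inner_neg_left, neg_eq_zero, real_inner_comm]
  exact (K.sub_starProjection_mem_orthogonal hu.toLp) _
    (Submodule.le_topologicalClosure _ ⟨ψ, hψ, rfl⟩)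

/-- A field that is orthogonal to all fields without divergence and normal flux is a limit of
gradients. -/
theorem inGradientClosure_of_orthogonal (hΩ : IsOpen Ω) {u : Plane → Plane}
    (hu : MemLp u 2 (volume.restrict Ω))
    (h : ∀ w : Plane → Plane, MemLp w 2 (volume.restrict Ω) →
      (∀ ψ, IsNeumannTest Ω ψ → ∫ x in Ω, inner ℝ (w x) (gradient ψ x) = 0) →
      ∫ x in Ω, inner ℝ (u x) (w x) = 0) : InGradientClosure Ω u := by
  have hmem : hu.toLp ∈ (testGradients hΩ).topologicalClosure := by
    rw [← Submodule.orthogonal_orthogonal_eq_closure, Submodule.mem_orthogonal']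
    intro w hw
    have h1 := h w (Lp.memLp w) fun ψ hψ => by
      rw [integral_inner_eq_inner_toLp (Lp.memLp w) hψ.memLp_gradient, Lp.toLp_coeFn]
      exact (Submodule.mem_orthogonal' _ _).1 hw _ ⟨ψ, hψ, rfl⟩
    rwa [integral_inner_eq_inner_toLp hu (Lp.memLp w), Lp.toLp_coeFn] at h1
  intro ε hε
  obtain ⟨ψ, hψ, h2⟩ := inGradientClosure_of_mem hmem ε hε
  refine ⟨ψ, hψ, le_trans (le_of_eq (eLpNorm_congr_ae ?_)) h2⟩
  filter_upwards [hu.coeFn_toLp] with x hx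
  rw [hx]

theorem InGradientClosure.weaklyIrrotational (hΩ : IsOpen Ω) {u : Plane → Plane}
    (hu : InGradientClosure Ω u) (hu2 : MemLp u 2 (volume.restrict Ω)) :
    WeaklyIrrotational Ω u := by
  intro Y hY hc hs hdiv
  have hYm : MemLp Y 2 (volume.restrict Ω) :=
    (hY.continuous.memLp_of_hasCompactSupport hc).restrict Ω
  have hle : ∀ ε > 0, |∫ x in Ω, inner ℝ (u x) (Y x)| ≤ ε * ‖hYm.toLp‖ := by
    intro ε hε
    obtain ⟨ψ, hψ, h⟩ := hu ε hε
    have h0 := weaklyIrrotational_gradient hΩ hψ.contDiffOn Y hY hc hs hdiv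
    rw [integral_inner_eq_inner_toLp hψ.memLp_gradient hYm] at h0
    rw [integral_inner_eq_inner_toLp hu2 hYm, ← abs_neg, ← zero_sub, ← h0, ← inner_sub_left]
    refine (abs_real_inner_le_norm _ _).trans ?_
    gcongr
    rw [← MemLp.toLp_sub, Lp.norm_toLp]
    exact ENNReal.toReal_le_of_le_ofReal hε.le h
  have hlim : Tendsto (fun ε : ℝ => ε * ‖hYm.toLp‖) (𝓝[>] 0) (𝓝 (0 * ‖hYm.toLp‖)) :=
    (tendsto_id.mul_const _).mono_left nhdsWithin_le_nhds
  rw [zero_mul] at hlim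
  exact abs_eq_zero.1 (le_antisymm (ge_of_tendsto hlim
    (by filter_upwards [self_mem_nhdsWithin] with ε hε using hle ε hε)) (abs_nonneg _))

end Projection

/-! ### The stream function -/

/-- The rotation of the plane by a right angle. -/
def rot : Plane →L[ℝ] Plane :=
  LinearMap.toContinuousLinearMap
    { toFun := fun v => !₂[-(v 1), v 0]
      map_add' := fun v w => by ext i; fin_cases i <;> simp [add_comm]
      map_smul' := fun c v => by ext i; fin_cases i <;> simp }

@[simp] theorem rot_apply_zero (v : Plane) : rot v 0 = -(v 1) := rfl

@[simp] theorem rot_apply_one (v : Plane) : rot v 1 = v 0 := rfl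

/-- The identification of the plane with its dual, as an `ℝ`-linear (instead of conjugate-linear)
map. -/
def planeDual : Plane →L[ℝ] Plane →L[ℝ] ℝ :=
  (isBoundedBilinearMap_inner (𝕜 := ℝ) (E := Plane)).toContinuousLinearMap

theorem planeDual_apply (v w : Plane) : planeDual v w = inner ℝ v w := rfl

theorem planeDual_gradient (h : Plane → ℝ) (x : Plane) :
    planeDual (gradient h x) = fderiv ℝ h x := by
  ext v
  rw [planeDual_apply, inner_gradient_left]

theorem inner_rot_left (v w : Plane) : inner ℝ (rot v) w = - inner ℝ v (rot w) := by
  simp [plane_inner]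

theorem inner_rot_rot (v w : Plane) : inner ℝ (rot v) (rot w) = inner ℝ v w := by
  simp [plane_inner]; ring

theorem memLp_rot {Ω : Set Plane} {u : Plane → Plane} (hu : MemLp u 2 (volume.restrict Ω)) :
    MemLp (fun x => rot (u x)) 2 (volume.restrict Ω) :=
  rot.comp_memLp' hu

/-- A rotated gradient is divergence-free. -/
theorem divergence_rot_gradient {h : Plane → ℝ} (hh : ContDiff ℝ 2 h) (x : Plane) :
    divergence (fun y => rot (gradient h y)) x = 0 := by
  have hg : DifferentiableAt ℝ (gradient h) x :=
    (contDiff_gradient (n := 1) (by simpa [one_add_one_eq_two] using hh)).differentiable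
      one_ne_zero x
  have h1 : HasFDerivAt (fun y => rot (gradient h y)) (rot.comp (fderiv ℝ (gradient h) x)) x :=
    rot.hasFDerivAt.comp x hg.hasFDerivAt
  have hsymm : IsSymmSndFDerivAt ℝ h x :=
    hh.contDiffAt.isSymmSndFDerivAt (by simp)
  have h2 : fderiv ℝ (fderiv ℝ h) x =
      planeDual.comp (fderiv ℝ (gradient h) x) := by
    have : fderiv ℝ h = fun y => planeDual (gradient h y) :=
      funext fun y => (planeDual_gradient h y).symm
    rw [this]
    exact (planeDual.hasFDerivAt.comp x hg.hasFDerivAt).fderiv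
  have h3 := hsymm (EuclideanSpace.single 0 1) (EuclideanSpace.single 1 1)
  rw [h2] at h3
  simp [planeDual_apply, plane_inner] at h3
  rw [h1.divergence_eq]
  simp [Fin.sum_univ_two, h3]

theorem divergence_smear {r : ℝ} (hr : 0 ≤ r) {f : Plane → Plane} (hf : LocallyIntegrable f)
    (x : Plane) : divergence (smear r f) x = ∫ y, fderiv ℝ (bump r) (x - y) (f y) := by
  have hi (e : Plane) : Integrable fun y => fderiv ℝ (bump r) (x - y) e • f y :=
    integrable_smul_of_locallyIntegrable (k := fun z => fderiv ℝ (bump r) z e)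
      (contDiff_fderiv_apply ((contDiff_bump r).of_le (by norm_num)) e)
      ((hasCompactSupport_bump hr).fderiv_apply (𝕜 := ℝ) e) hf x
  have hc (i : Fin 2) (e : Plane) : (∫ y, fderiv ℝ (bump r) (x - y) e • f y) i =
      ∫ y, fderiv ℝ (bump r) (x - y) e * f y i := by
    have := (EuclideanSpace.proj (𝕜 := ℝ) i).integral_comp_comm (hi e)
    simpa using this.symm
  have hic (i : Fin 2) (e : Plane) : Integrable fun y => fderiv ℝ (bump r) (x - y) e * f y i := by
    have := (EuclideanSpace.proj (𝕜 := ℝ) i).integrable_comp (hi e)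
    simpa using this
  simp only [divergence, fderiv_smear_apply hr hf, hc]
  rw [← integral_finsetSum _ fun i _ => hic i _]
  congr 1
  ext y
  conv_rhs => rw [plane_eta (f y)]
  simp [Fin.sum_univ_two, mul_comm]

theorem divergence_smear_indicator {Ω : Set Plane} (hΩ : IsOpen Ω) {w : Plane → Plane}
    (hw : LocallyIntegrable (Ω.indicator w)) {r : ℝ} (hr : 0 ≤ r) (x : Plane) :
    divergence (smear r (Ω.indicator w)) x =
      - ∫ y in Ω, inner ℝ (w y) (gradient (fun y => bump r (x - y)) y) := by
  rw [divergence_smear hr hw, ← integral_indicator hΩ.measurableSet, ← integral_neg]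
  congr 1
  ext y
  by_cases hy : y ∈ Ω
  · rw [Set.indicator_of_mem hy, Set.indicator_of_mem hy, real_inner_comm, inner_gradient_left,
      fderiv_bump_sub]
    simp
  · simp [hy]

/-- A continuously differentiable solenoidal field on the plane with compact support is a rotated
gradient of a potential with compact support. -/
theorem exists_gradient_eq_rot {W : Plane → Plane} (hW : ContDiff ℝ 1 W)
    (hc : HasCompactSupport W) (hdiv : ∀ x, divergence W x = 0) :
    ∃ g : Plane → ℝ, ContDiff ℝ 1 g ∧ HasCompactSupport g ∧
      (∀ x, HasGradientAt g (rot (W x)) x) := by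
  set T : Plane →L[ℝ] Plane →L[ℝ] ℝ := planeDual.comp rot with hT
  have hTa (v w : Plane) : T v w = inner ℝ (rot v) w := rfl
  have hd (x) : HasFDerivAt (fun x => T (W x)) (T.comp (fderiv ℝ W x)) x :=
    T.hasFDerivAt.comp x (hW.differentiable one_ne_zero x).hasFDerivAt
  obtain ⟨g, hg⟩ := convex_univ.exists_forall_hasFDerivAt_of_fderiv_symmetric isOpen_univ
    (ω := fun x => T (W x)) (fun x _ => (hd x).differentiableAt.differentiableWithinAt)
    (fun a _ v w => by
      have h0 := hdiv a
      simp only [divergence, Fin.sum_univ_two] at h0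
      simp only [(hd a).fderiv, ContinuousLinearMap.comp_apply, hTa]
      rw [plane_eta v, plane_eta w]
      simp [plane_inner]
      linear_combination (v 0 * w 1 - v 1 * w 0) * h0)
  have hg' (x) : HasFDerivAt g (T (W x)) x := hg x (Set.mem_univ x)
  obtain ⟨R, hR⟩ := hc.isCompact.isBounded.subset_closedBall 0
  have hz (x : Plane) (hx : R < ‖x‖) : W x = 0 := image_eq_zero_of_notMem_tsupport fun h => by
    have := hR h
    rw [mem_closedBall_zero_iff] at this
    linarith
  set p : Plane := EuclideanSpace.single 0 (|R| + 1) with hp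
  have hpR : R < ‖p‖ := by
    rw [hp, PiLp.norm_single, Real.norm_of_nonneg (by positivity)]
    linarith [le_abs_self R]
  have hgc (x : Plane) (hx : R < ‖x‖) : g x = g p :=
    (isPreconnected_lt_norm R).eq_of_fderiv_eq_zero (fun x => (hg' x).differentiableAt)
      (isOpen_lt continuous_const continuous_norm)
      (fun x hx => by rw [(hg' x).fderiv, hz x hx, map_zero]) subset_rfl hx hpR
  refine ⟨fun x => g x - g p, ?_, ?_, fun x => ?_⟩
  · rw [contDiff_one_iff_fderiv]
    refine ⟨fun x => ((hg' x).sub_const _).differentiableAt, ?_⟩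
    have : fderiv ℝ (fun x => g x - g p) = fun x => T (W x) :=
      funext fun x => ((hg' x).sub_const _).fderiv
    rw [this]
    exact T.continuous.comp hW.continuous
  · refine HasCompactSupport.intro (isCompact_closedBall (0 : Plane) R) fun x hx => ?_
    rw [hgc x (by simpa using hx), sub_self]
  · rw [hasGradientAt_iff_hasFDerivAt]
    exact (hg' x).sub_const _

/-- Mollification is symmetric. -/
theorem integral_inner_smear_comm {K Ω : Set Plane} (hK : MeasurableSet K) (hΩ : MeasurableSet Ω)
    {u w : Plane → Plane} (hu : IntegrableOn u K) (hw : IntegrableOn w Ω) {r : ℝ} (hr : 0 ≤ r) :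
    ∫ x in K, inner ℝ (u x) (smear r (Ω.indicator w) x) =
      ∫ y in Ω, inner ℝ (smear r (K.indicator u) y) (w y) := by
  have hl {f : Plane → Plane} {S : Set Plane} (hS : MeasurableSet S) (hf : IntegrableOn f S) :
      LocallyIntegrable (S.indicator f) := (hf.integrable_indicator hS).locallyIntegrable
  have hbc : Continuous fun p : Plane × Plane => bump r (p.1 - p.2) :=
    (contDiff_bump r).continuous.comp (continuous_fst.sub continuous_snd)
  have hint : Integrable (Function.uncurry fun x y => bump r (x - y) * inner ℝ (u x) (w y))
      ((volume.restrict K).prod (volume.restrict Ω)) := by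
    have h1 := (Integrable.mul_prod hu.norm hw.norm).const_mul (r ^ 6)
    refine h1.mono' ?_ (Eventually.of_forall fun p => ?_)
    · exact hbc.aestronglyMeasurable.mul
        ((hu.aestronglyMeasurable.comp_fst).inner (hw.aestronglyMeasurable.comp_snd))
    · rw [Function.uncurry_def, norm_mul, Real.norm_of_nonneg (bump_nonneg _ _)]
      exact mul_le_mul (bump_le _ _) (norm_inner_le_norm (𝕜 := ℝ) _ _) (norm_nonneg _)
        (by positivity)
  have h1 (x : Plane) : inner ℝ (u x) (smear r (Ω.indicator w) x) =
      ∫ y in Ω, bump r (x - y) * inner ℝ (u x) (w y) := by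
    rw [smear, ← integral_inner (integrable_smul_of_locallyIntegrable
      (contDiff_bump r).continuous (hasCompactSupport_bump hr) (hl hΩ hw) x),
      ← integral_indicator hΩ]
    congr 1
    ext y
    by_cases hy : y ∈ Ω <;> simp [hy, real_inner_smul_right]
  have h2 (y : Plane) : inner ℝ (smear r (K.indicator u) y) (w y) =
      ∫ x in K, bump r (x - y) * inner ℝ (u x) (w y) := by
    rw [real_inner_comm, smear, ← integral_inner (integrable_smul_of_locallyIntegrable
      (contDiff_bump r).continuous (hasCompactSupport_bump hr) (hl hK hu) y),
      ← integral_indicator hK]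
    congr 1
    ext x
    rw [← bump_neg, neg_sub]
    by_cases hx : x ∈ K <;> simp [hx, real_inner_smul_right, real_inner_comm]
  simp only [h1, h2]
  exact integral_integral_swap hint

theorem smear_eq_zero_of_notMem_cthickening {Ω : Set Plane} {w : Plane → Plane} {r : ℝ}
    (hr : 0 ≤ r) {x : Plane} (hx : x ∉ Metric.cthickening r Ω) :
    smear r (Ω.indicator w) x = 0 := by
  refine integral_eq_zero_of_ae (Eventually.of_forall fun y => ?_)
  by_cases hy : y ∈ Ω
  · have : r ≤ ‖x - y‖ := by
      rw [← dist_eq_norm]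
      by_contra h
      exact hx (Metric.mem_cthickening_of_dist_le x y r Ω hy (not_le.1 h).le)
    simp [bump_eq_zero hr this]
  · simp [hy]

/-- A field without periods and fluxes has a single-valued stream function. Fields `w` orthogonal to
all gradients on `O` are mollified to solenoidal fields `W` on the plane, and `rot ∘ W` is the
gradient of a function `g` to which the vanishing of the fluxes applies. -/
theorem exists_stream_function {D : Set Plane} (hD : IsOpen D) {u : Plane → Plane}
    (hu : MemLp u 2 (volume.restrict D)) (huc : ContinuousOn u D) (hirr : WeaklyIrrotational D u)
    (hflux : ∀ g : Plane → ℝ, ContDiff ℝ 1 g → HasCompactSupport g →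
      tsupport (fderiv ℝ g) ⊆ D → ∫ x in D, inner ℝ (u x) (gradient g x) = 0)
    {O : Set Plane} (hO : IsOpen O) (hOc : IsCompact (closure O)) (hOD : closure O ⊆ D) :
    ∃ θ : Plane → ℝ, ∀ x ∈ O, HasGradientAt θ (rot (u x)) x := by
  have hOD' : O ⊆ D := subset_closure.trans hOD
  have hsol : WeaklySolenoidal D u := fun h hh hc hs =>
    hflux h hh hc ((tsupport_fderiv_subset ℝ).trans hs)
  have huO : MemLp (fun x => rot (u x)) 2 (volume.restrict O) :=
    memLp_rot (hu.mono_measure (Measure.restrict_mono_set _ hOD'))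
  refine InGradientClosure.exists_hasGradientAt hO (inGradientClosure_of_orthogonal hO huO
    fun w hw hwψ => ?_) huO (rot.continuous.comp_continuousOn (huc.mono hOD'))
  obtain ⟨r, hr, hrD⟩ := hOc.exists_cthickening_subset_open hD hOD
  rw [Metric.cthickening_closure] at hrD
  set K := Metric.cthickening r O with hKdef
  have hKc : IsCompact K := by
    have := hOc.cthickening (r := r)
    rwa [Metric.cthickening_closure] at this
  have hOK : O ⊆ K := Metric.self_subset_cthickening O
  have hwl := locallyIntegrable_indicator hO hw
  set W := smear r (O.indicator w) with hWdef
  have hWd : ContDiff ℝ 1 W := (contDiff_smear hr.le hwl).of_le (by norm_num)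
  have hWK (x) (hx : x ∉ K) : W x = 0 := smear_eq_zero_of_notMem_cthickening hr.le hx
  have hWc : HasCompactSupport W := HasCompactSupport.intro hKc hWK
  have hWdiv (x) : divergence W x = 0 := by
    rw [hWdef, divergence_smear_indicator hO hwl hr.le, hwψ _
      (isNeumannTest_of_hasCompactSupport O ((contDiff_bump_sub r x).of_le (by norm_num))
        (hasCompactSupport_bump_sub hr.le x)), neg_zero]
  obtain ⟨g, hgd, hgc, hg⟩ := exists_gradient_eq_rot hWd hWc hWdiv
  have h1 := hflux g hgd hgc <| by
    refine (closure_minimal (fun x hx => ?_) hKc.isClosed).trans hrD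
    by_contra h
    refine hx ?_
    rw [(hasGradientAt_iff_hasFDerivAt.1 (hg x)).fderiv, hWK x h]
    simp
  have h2 : ∫ x in D, inner ℝ (u x) (gradient g x) =
      - ∫ x in K, inner ℝ (rot (u x)) (W x) := by
    rw [setIntegral_eq_of_subset_of_forall_sdiff_eq_zero hD.measurableSet hrD, ← integral_neg]
    · congr 1
      ext x
      rw [(hg x).gradient, inner_rot_left, neg_neg]
    · intro x hx
      rw [(hg x).gradient, hWK x hx.2, map_zero, inner_zero_right]
  have hint {S : Set Plane} (hS : IsCompact (closure S)) {v : Plane → Plane}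
      (hv : MemLp v 2 (volume.restrict S)) : IntegrableOn v S := by
    have : IsFiniteMeasure (volume.restrict S) :=
      ⟨by simpa using (measure_mono subset_closure).trans_lt hS.measure_lt_top⟩
    exact hv.integrable (by norm_num)
  have huK : MemLp u 2 (volume.restrict K) := hu.mono_measure (Measure.restrict_mono_set _ hrD)
  have huKi : IntegrableOn u K := hint (by rwa [hKc.isClosed.closure_eq]) huK
  have h3 := integral_inner_smear_comm hKc.measurableSet hO.measurableSet
    (rot.integrable_comp huKi) (hint hOc hw) hr.le
  rw [h2, neg_eq_zero] at h1
  rw [← hWdef, h1] at h3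
  have hmean := ae_smear_eq_smul hD hsol hirr (locallyIntegrable_indicator hD hu)
  have hm : 0 < bumpMass * r ^ 8 := mul_pos bumpMass_pos (by positivity)
  have h4 : ∫ y in O, inner ℝ (smear r (K.indicator fun x => rot (u x)) y) (w y) =
      ∫ y in O, (bumpMass * r ^ 8) * inner ℝ (rot (u y)) (w y) := by
    refine integral_congr_ae ?_
    filter_upwards [ae_restrict_of_ae hmean, ae_restrict_mem hO.measurableSet] with y hy hyO
    have hball : Metric.closedBall y r ⊆ K := Metric.closedBall_subset_cthickening hyO r
    have hswap : smear r (K.indicator fun x => rot (u x)) y = rot (smear r (D.indicator u) y) := by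
      simp only [smear]
      rw [← rot.integral_comp_comm (integrable_smul_of_locallyIntegrable
        (contDiff_bump r).continuous (hasCompactSupport_bump hr.le)
        (locallyIntegrable_indicator hD hu) y)]
      congr 1
      ext1 z
      by_cases hz : z ∈ K
      · simp [hz, hrD hz]
      · rw [bump_eq_zero hr.le (by
          rw [← dist_eq_norm, dist_comm]
          exact (not_le.1 fun h => hz (hball h)).le)]
        simp
    rw [hswap, hy r hr (hball.trans hrD), map_smul, real_inner_smul_left]
  rw [h4, integral_const_mul] at h3
  exact (mul_eq_zero.1 h3.symm).resolve_left hm.ne'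

/-! ### Potentials of weakly solenoidal limits of gradients -/

/-- The `L²` norm of a function on discs of fixed radius tends to zero at infinity. -/
theorem tendsto_eLpNorm_closedBall {f : Plane → Plane} (hf : MemLp f 2) (r : ℝ) :
    Tendsto (fun x => eLpNorm f 2 (volume.restrict (Metric.closedBall x r))) (cocompact Plane)
      (𝓝 0) := by
  rw [ENNReal.tendsto_nhds_zero]
  intro ε hε
  obtain ⟨g, hgc, hg, hgcont, hgm⟩ :=
    hf.exists_hasCompactSupport_eLpNorm_sub_le (by norm_num) hε.ne'
  filter_upwards [(hgc.isCompact.cthickening (r := r)).compl_mem_cocompact] with x hx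
  have hz (y) (hy : y ∈ Metric.closedBall x r) : g y = 0 := image_eq_zero_of_notMem_tsupport
    fun h => hx (Metric.mem_cthickening_of_dist_le x y r _ h
      (by rw [dist_comm]; exact hy))
  calc eLpNorm f 2 (volume.restrict (Metric.closedBall x r))
      = eLpNorm (f - g) 2 (volume.restrict (Metric.closedBall x r)) := by
        refine eLpNorm_congr_ae ?_
        filter_upwards [ae_restrict_mem Metric.isClosed_closedBall.measurableSet] with y hy
        simp [hz y hy]
    _ ≤ eLpNorm (f - g) 2 volume := eLpNorm_mono_measure _ Measure.restrict_le_self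
    _ ≤ ε := hg

theorem laplacian_eq_divergence_gradient {φ : Plane → ℝ} {v : Plane → Plane} {x : Plane}
    (hφ : ∀ᶠ y in 𝓝 x, HasGradientAt φ (v y) y) (hv : DifferentiableAt ℝ v x) :
    Laplacian.laplacian φ x = divergence v x := by
  have h1 : fderiv ℝ φ =ᶠ[𝓝 x] fun y => planeDual (v y) := by
    filter_upwards [hφ] with y hy
    rw [← planeDual_gradient, hy.gradient]
  have h2 : fderiv ℝ (fderiv ℝ φ) x = planeDual.comp (fderiv ℝ v x) :=
    h1.fderiv_eq.trans (planeDual.hasFDerivAt.comp x hv.hasFDerivAt).fderiv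
  rw [InnerProductSpace.laplacian_eq_iteratedFDeriv_orthonormalBasis φ
    (EuclideanSpace.basisFun (Fin 2) ℝ)]
  simp only [iteratedFDeriv_two_apply, h2, divergence]
  refine Finset.sum_congr rfl fun i _ => ?_
  fin_cases i <;> simp [planeDual_apply, plane_inner]

/-- A weakly solenoidal field in the closure of the gradients agrees almost everywhere with the
velocity field of a potential flow. The smooth representative is the normalized mollification with
any radius smaller than the distance from the complement of `Ω`. -/
theorem exists_isPotentialFlow {Ω : Set Plane} (hΩ : IsOpen Ω) {u : Plane → Plane}
    (hu : MemLp u 2 (volume.restrict Ω)) (hcl : InGradientClosure Ω u)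
    (hsol : WeaklySolenoidal Ω u) :
    ∃ φ : Plane → ℝ, IsPotentialFlow Ω φ ∧ gradient φ =ᵐ[volume.restrict Ω] u := by
  have hirr := hcl.weaklyIrrotational hΩ hu
  have hl := locallyIntegrable_indicator hΩ hu
  have hball (x : Plane) (hx : x ∈ Ω) : ∃ r > 0, Metric.closedBall x r ⊆ Ω := by
    obtain ⟨r, hr, h⟩ := Metric.isOpen_iff.1 hΩ x hx
    exact ⟨r / 2, by positivity, (Metric.closedBall_subset_ball (by linarith)).trans h⟩
  choose! ρ hρ0 hρ using hball
  set v : Plane → Plane := fun x => (bumpMass * ρ x ^ 8)⁻¹ • smear (ρ x) (Ω.indicator u) x with hv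
  have hveq (x : Plane) (r : ℝ) (hr : 0 < r) (h : Metric.closedBall x r ⊆ Ω) :
      v x = (bumpMass * r ^ 8)⁻¹ • smear r (Ω.indicator u) x := by
    have hx := h (Metric.mem_closedBall_self hr.le)
    simp only [hv, mul_inv, mul_smul]
    congr 1
    rcases le_total (ρ x) r with hle | hle
    · exact smear_scaling hΩ hsol hirr hl (hρ0 x hx) hle h
    · exact (smear_scaling hΩ hsol hirr hl hr hle (hρ x hx)).symm
  have hvloc (x : Plane) (hx : x ∈ Ω) : ∃ r > 0, Metric.closedBall x r ⊆ Ω ∧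
      v =ᶠ[𝓝 x] fun y => (bumpMass * r ^ 8)⁻¹ • smear r (Ω.indicator u) y := by
    refine ⟨ρ x / 2, half_pos (hρ0 x hx), (Metric.closedBall_subset_closedBall
      (half_le_self (hρ0 x hx).le)).trans (hρ x hx), ?_⟩
    filter_upwards [Metric.ball_mem_nhds x (half_pos (hρ0 x hx))] with y hy
    refine hveq y _ (half_pos (hρ0 x hx)) ((Metric.closedBall_subset_closedBall' ?_).trans
      (hρ x hx))
    linarith [Metric.mem_ball.1 hy]
  have hvd (x : Plane) (hx : x ∈ Ω) : ContDiffAt ℝ 2 v x := by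
    obtain ⟨r, hr, -, h⟩ := hvloc x hx
    exact ((contDiff_smear hr.le hl).const_smul _).contDiffAt.congr_of_eventuallyEq h
  have hvu : v =ᵐ[volume.restrict Ω] u := by
    filter_upwards [ae_restrict_of_ae (ae_smear_eq_smul hΩ hsol hirr hl),
      ae_restrict_mem hΩ.measurableSet] with x hx hxΩ
    have hm : 0 < bumpMass * ρ x ^ 8 := mul_pos bumpMass_pos (pow_pos (hρ0 x hxΩ) 8)
    simp only [hv]
    rw [hx _ (hρ0 x hxΩ) (hρ x hxΩ), inv_smul_smul₀ hm.ne']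
  have hvm : MemLp v 2 (volume.restrict Ω) := hu.ae_eq hvu.symm
  have hvcl : InGradientClosure Ω v := fun ε hε => by
    obtain ⟨ψ, hψ, h⟩ := hcl ε hε
    refine ⟨ψ, hψ, le_trans (le_of_eq (eLpNorm_congr_ae ?_)) h⟩
    filter_upwards [hvu] with x hx
    rw [hx]
  obtain ⟨φ, hφ⟩ := hvcl.exists_hasGradientAt hΩ hvm
    fun x hx => (hvd x hx).continuousAt.continuousWithinAt
  have hgrad : gradient φ =ᵐ[volume.restrict Ω] v := by
    filter_upwards [ae_restrict_mem hΩ.measurableSet] with x hx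
    exact (hφ x hx).gradient
  have hdiv (x : Plane) (hx : x ∈ Ω) : divergence v x = 0 := by
    obtain ⟨r, hr, hrΩ, h⟩ := hvloc x hx
    have hd := (contDiff_smear hr.le hl).differentiable two_ne_zero x
    rw [h.divergence_eq, divergence_smul (differentiableAt_const _) hd,
      divergence_smear_indicator hΩ hl hr.le, hsol _ ((contDiff_bump_sub r x).of_le (by norm_num))
        (hasCompactSupport_bump_sub hr.le x) ((tsupport_bump_sub_subset hr.le x).trans hrΩ)]
    simp
  have hnear (x : Plane) (hx : x ∈ Ω) : ∀ᶠ y in 𝓝 x, HasGradientAt φ (v y) y := by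
    filter_upwards [hΩ.mem_nhds hx] with y hy using hφ y hy
  refine ⟨φ, ⟨fun x hx => ⟨?_, ?_⟩, hvm.ae_eq hgrad.symm, ?_⟩, hgrad.trans hvu⟩
  · rw [show (2 : WithTop ℕ∞) = (1 : ℕ) + 1 by norm_num, contDiffAt_succ_iff_hasFDerivAt]
    refine ⟨fun y => planeDual (v y), ⟨Ω, hΩ.mem_nhds hx, fun y hy => ?_⟩, ?_⟩
    · exact (hφ y hy).hasFDerivAt
    · exact planeDual.contDiff.contDiffAt.comp x ((hvd x hx).of_le (by norm_num))
  · filter_upwards [hΩ.mem_nhds hx] with y hy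
    rw [laplacian_eq_divergence_gradient (hnear y hy)
      ((hvd y hy).differentiableAt two_ne_zero), hdiv y hy]
    rfl
  · intro δ hδ
    set r := δ / 2 with hr
    have hr0 : 0 < r := half_pos hδ
    have hum : MemLp (Ω.indicator u) 2 := (memLp_indicator_iff_restrict hΩ.measurableSet).2 hu
    have htail : Tendsto (fun x => (bumpMass * r ^ 8)⁻¹ * (r ^ 6 * (√(Real.pi * r ^ 2) *
        (eLpNorm (Ω.indicator u) 2 (volume.restrict (Metric.closedBall x r))).toReal)))
        (cocompact Plane) (𝓝 0) := by
      have h1 := (ENNReal.tendsto_toReal (by simp)).comp (tendsto_eLpNorm_closedBall hum r)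
      simpa using ((h1.const_mul _).const_mul _).const_mul _
    refine squeeze_zero_norm' ?_ (htail.mono_left inf_le_left)
    filter_upwards [mem_inf_of_right (mem_principal_self _)] with x hx
    have hsub : Metric.closedBall x r ⊆ Ω :=
      (Metric.closedBall_subset_ball (by linarith)).trans hx
    have hm : 0 < bumpMass * r ^ 8 := mul_pos bumpMass_pos (pow_pos hr0 8)
    rw [(hφ x (hsub (Metric.mem_closedBall_self hr0.le))).gradient, hveq x r hr0 hsub, norm_smul,
      norm_inv, Real.norm_of_nonneg hm.le]
    gcongr
    refine (norm_smear_indicator_le hΩ hu hr0 hsub).trans_eq ?_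
    congr 3
    refine eLpNorm_congr_ae ?_
    filter_upwards [ae_restrict_mem Metric.isClosed_closedBall.measurableSet] with y hy
    rw [Set.indicator_of_mem (hsub hy)]

/-! ### Extension of test functions by zero -/

/-- `F` vanishes on `Ω` near the boundary point `x`. -/
def VanishesNear (Ω : Set Plane) (F : Plane → ℝ) (x : Plane) : Prop :=
  ∀ᶠ y in 𝓝 x, y ∈ Ω → F y = 0

theorem VanishesNear.indicator_eventuallyEq {Ω : Set Plane} {F : Plane → ℝ} {x : Plane}
    (h : VanishesNear Ω F x) : Ω.indicator F =ᶠ[𝓝 x] 0 := by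
  filter_upwards [h] with y hy
  by_cases hyΩ : y ∈ Ω
  · simp [hyΩ, hy hyΩ]
  · simp [hyΩ]

theorem vanishesNear_of_notMem_frontier {Ω U : Set Plane} (hΩ : IsOpen Ω) (hU : IsOpen U)
    {F : Plane → ℝ} (hF : ∀ x ∈ U ∩ Ω, F x = 0) {x : Plane} (hx : x ∉ Ω)
    (hxU : x ∈ frontier Ω → x ∈ U) : VanishesNear Ω F x := by
  by_cases hc : x ∈ closure Ω
  · have : x ∈ frontier Ω := by rw [hΩ.frontier_eq]; exact ⟨hc, hx⟩
    filter_upwards [hU.mem_nhds (hxU this)] with y hy hyΩ using hF y ⟨hy, hyΩ⟩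
  · filter_upwards [isClosed_closure.isOpen_compl.mem_nhds hc] with y hy hyΩ
    exact absurd (subset_closure hyΩ) hy

theorem indicator_eventuallyEq_self {Ω : Set Plane} (hΩ : IsOpen Ω) (F : Plane → ℝ) {x : Plane}
    (hx : x ∈ Ω) : Ω.indicator F =ᶠ[𝓝 x] F := by
  filter_upwards [hΩ.mem_nhds hx] with y hy
  simp [hy]

theorem gradient_indicator {Ω : Set Plane} (hΩ : IsOpen Ω) {F : Plane → ℝ} {x : Plane}
    (h : x ∉ Ω → VanishesNear Ω F x) :
    gradient (Ω.indicator F) x = Ω.indicator (gradient F) x := by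
  by_cases hx : x ∈ Ω
  · rw [Set.indicator_of_mem hx, (indicator_eventuallyEq_self hΩ F hx).gradient_eq]
  · rw [Set.indicator_of_notMem hx, (h hx).indicator_eventuallyEq.gradient_eq]
    simp [gradient]

theorem contDiffAt_indicator {Ω : Set Plane} (hΩ : IsOpen Ω) {F : Plane → ℝ}
    (hF : ContDiffOn ℝ 1 F Ω) {x : Plane} (h : x ∉ Ω → VanishesNear Ω F x) :
    ContDiffAt ℝ 1 (Ω.indicator F) x := by
  by_cases hx : x ∈ Ω
  · exact (hF.contDiffAt (hΩ.mem_nhds hx)).congr_of_eventuallyEq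
      (indicator_eventuallyEq_self hΩ F hx)
  · exact (contDiffAt_const (c := (0 : ℝ))).congr_of_eventuallyEq (h hx).indicator_eventuallyEq

/-- A test function with zero boundary values, extended by zero, is compactly supported in `Ω`. -/
theorem IsNeumannTest.extend {Ω : Set Plane} (hΩ : IsOpen Ω) {F : Plane → ℝ}
    (hF : IsNeumannTest Ω F) (h : ∀ x ∉ Ω, VanishesNear Ω F x) :
    ContDiff ℝ 1 (Ω.indicator F) ∧ HasCompactSupport (Ω.indicator F) ∧
      tsupport (Ω.indicator F) ⊆ Ω := by
  refine ⟨contDiff_iff_contDiffAt.2 fun x => contDiffAt_indicator hΩ hF.contDiffOn (h x), ?_, ?_⟩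
  · obtain ⟨R, hR⟩ := hF.bounded_support
    refine HasCompactSupport.intro (isCompact_closedBall (0 : Plane) R) fun x hx => ?_
    by_cases hxΩ : x ∈ Ω
    · rw [Set.indicator_of_mem hxΩ]
      exact hR x hxΩ (by simpa using hx)
    · simp [hxΩ]
  · intro x hx
    by_contra hxΩ
    exact (notMem_tsupport_iff_eventuallyEq.2 (h x hxΩ).indicator_eventuallyEq) hx

theorem IsNeumannTest.extend_of_subset {Ω D : Set Plane} (hΩ : IsOpen Ω)
    {F : Plane → ℝ} (hF : IsNeumannTest Ω F)
    (h : ∀ x ∈ D \ Ω, VanishesNear Ω F x) (hD : MeasurableSet D) :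
    IsNeumannTest D (Ω.indicator F) where
  contDiffOn x hx := (contDiffAt_indicator hΩ hF.contDiffOn
    fun hxΩ => h x ⟨hx, hxΩ⟩).contDiffWithinAt
  memLp := ((memLp_indicator_iff_restrict hΩ.measurableSet).2 hF.memLp).restrict D
  memLp_gradient := by
    refine (((memLp_indicator_iff_restrict hΩ.measurableSet).2 hF.memLp_gradient).restrict
      D).ae_eq ?_
    filter_upwards [ae_restrict_mem hD] with x hx
    exact (gradient_indicator hΩ fun hxΩ => h x ⟨hx, hxΩ⟩).symm
  bounded_support := by
    obtain ⟨R, hR⟩ := hF.bounded_support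
    refine ⟨R, fun x _ hx => ?_⟩
    by_cases hxΩ : x ∈ Ω
    · rw [Set.indicator_of_mem hxΩ]
      exact hR x hxΩ hx
    · simp [hxΩ]

theorem IsNeumannTest.mono {Ω D : Set Plane} (h : Ω ⊆ D) {F : Plane → ℝ}
    (hF : IsNeumannTest D F) : IsNeumannTest Ω F where
  contDiffOn := hF.contDiffOn.mono h
  memLp := hF.memLp.mono_measure (Measure.restrict_mono_set _ h)
  memLp_gradient := hF.memLp_gradient.mono_measure (Measure.restrict_mono_set _ h)
  bounded_support := by
    obtain ⟨R, hR⟩ := hF.bounded_support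
    exact ⟨R, fun x hx => hR x (h hx)⟩

theorem memLp_bdd_smul {Ω : Set Plane} {E : Type*} [NormedAddCommGroup E] [NormedSpace ℝ E]
    {f : Plane → E} {σ : Plane → ℝ} (hσ : Continuous σ) {c : ℝ}
    (hb : ∀ x, |σ x| ≤ c) (hf : MemLp f 2 (volume.restrict Ω)) :
    MemLp (fun x => σ x • f x) 2 (volume.restrict Ω) :=
  hf.of_le_mul (c := c) (hσ.aestronglyMeasurable.smul hf.1) (Eventually.of_forall fun x => by
    rw [norm_smul]
    exact mul_le_mul_of_nonneg_right (hb x) (norm_nonneg _))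

theorem IsNeumannTest.mul_cutoff {Ω : Set Plane} (hΩ : IsOpen Ω) {F σ : Plane → ℝ}
    (hF : IsNeumannTest Ω F) (hσ : ContDiff ℝ 1 σ) {c : ℝ} (hb : ∀ x, |σ x| ≤ c)
    (hc : HasCompactSupport (fderiv ℝ σ)) : IsNeumannTest Ω (fun x => σ x * F x) where
  contDiffOn := hσ.contDiffOn.mul hF.contDiffOn
  memLp := memLp_bdd_smul hσ.continuous hb hF.memLp
  memLp_gradient := by
    have hgs : Continuous (gradient σ) :=
      (contDiff_gradient (n := 0) (by simpa using hσ)).continuous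
    have hgc : HasCompactSupport (gradient σ) := hc.mono fun x hx h => hx (by simp [gradient, h])
    obtain ⟨K, hK⟩ := hgs.bounded_above_of_compact_support hgc
    have h2 : MemLp (fun x => F x • gradient σ x) 2 (volume.restrict Ω) :=
      hF.memLp.of_le_mul (c := K) (hF.memLp.1.smul hgs.aestronglyMeasurable)
        (Eventually.of_forall fun x => by
          rw [norm_smul, mul_comm]
          exact mul_le_mul_of_nonneg_right (hK x) (norm_nonneg _))
    refine ((memLp_bdd_smul hσ.continuous hb hF.memLp_gradient).add h2).ae_eq ?_
    filter_upwards [ae_restrict_mem hΩ.measurableSet] with x hx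
    exact (gradient_fun_mul (hσ.differentiable one_ne_zero x)
      (hF.differentiableAt hΩ hx)).symm
  bounded_support := by
    obtain ⟨R, hR⟩ := hF.bounded_support
    exact ⟨R, fun x hx h => by rw [hR x hx h, mul_zero]⟩

/-- The integrand of the weak boundary condition is integrable. -/
theorem IsNeumannTest.integrableOn_noFlux {Ω : Set Plane} (hΩ : IsOpen Ω) {F : Plane → ℝ}
    (hF : IsNeumannTest Ω F) {V u : Plane → Plane} (hV : ContDiff ℝ 1 V)
    (hu : MemLp u 2 (volume.restrict Ω)) :
    IntegrableOn (fun x => inner ℝ (u x - V x) (gradient F x) - F x * divergence V x) Ω := by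
  obtain ⟨R, hR⟩ := hF.bounded_support
  have hKc : IsCompact (Metric.closedBall (0 : Plane) R) := isCompact_closedBall _ _
  have hloc {E : Type} [NormedAddCommGroup E] (f : Plane → E) (hf : Continuous f) :
      MemLp ((Metric.closedBall (0 : Plane) R).indicator f) 2 (volume.restrict Ω) := by
    refine ((memLp_indicator_iff_restrict hKc.measurableSet).2 ?_).restrict Ω
    obtain ⟨c, hc⟩ := hKc.exists_bound_of_continuousOn hf.continuousOn
    have : IsFiniteMeasure (volume.restrict (Metric.closedBall (0 : Plane) R)) :=
      ⟨by simpa using hKc.measure_lt_top (μ := (volume : Measure Plane))⟩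
    refine MemLp.of_bound (hf.continuousOn.aestronglyMeasurable_of_isCompact hKc
      hKc.measurableSet) c ?_
    filter_upwards [ae_restrict_mem hKc.measurableSet] with x hx using hc x hx
  have h1 := (integrableOn_inner hu hF.memLp_gradient).sub
    (integrableOn_inner (hloc V hV.continuous) hF.memLp_gradient)
  have h2 : IntegrableOn (fun x => F x * (Metric.closedBall (0 : Plane) R).indicator
      (divergence V) x) Ω := hF.memLp.integrable_mul (hloc _ (continuous_divergence hV))
  refine (h1.sub h2).congr ?_
  filter_upwards [ae_restrict_mem hΩ.measurableSet] with x hx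
  simp only [Pi.sub_apply]
  by_cases hxR : x ∈ Metric.closedBall (0 : Plane) R
  · rw [Set.indicator_of_mem hxR, Set.indicator_of_mem hxR, inner_sub_left]
  · have hx' : R < ‖x‖ := by simpa using hxR
    have hg : gradient F x = 0 := by
      have : F =ᶠ[𝓝 x] fun _ => 0 := by
        filter_upwards [hΩ.mem_nhds hx, (isOpen_lt continuous_const continuous_norm).mem_nhds hx']
          with y hy hyR using hR y hy hyR
      rw [this.gradient_eq, gradient_fun_const]
    simp [hg, hR x hx hx']

/-- Restriction of the weak boundary condition to test functions that vanish near the body. -/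
theorem setIntegral_noFlux_indicator {Ω D : Set Plane} (hΩ : IsOpen Ω) (hD : MeasurableSet D)
    (hΩD : Ω ⊆ D) {F : Plane → ℝ} (h : ∀ x ∈ D \ Ω, VanishesNear Ω F x) (V u : Plane → Plane) :
    ∫ x in D, (inner ℝ (u x - V x) (gradient (Ω.indicator F) x) -
        Ω.indicator F x * divergence V x) =
      ∫ x in Ω, (inner ℝ (u x - V x) (gradient F x) - F x * divergence V x) := by
  rw [setIntegral_eq_of_subset_of_forall_sdiff_eq_zero hD hΩD]
  · apply setIntegral_congr_fun hΩ.measurableSet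
    intro x hx
    simp only
    rw [gradient_indicator hΩ fun hxΩ => absurd hx hxΩ, Set.indicator_of_mem hx,
      Set.indicator_of_mem hx]
  · intro x hx
    rw [gradient_indicator hΩ fun _ => h x hx, Set.indicator_of_notMem hx.2,
      Set.indicator_of_notMem hx.2]
    simp

/-- A field whose fluxes vanish is orthogonal to the gradients of test functions with zero boundary
values. -/
theorem integral_inner_gradient_eq_zero_of_vanishesNear {Ω D : Set Plane} (hΩ : IsOpen Ω)
    (hD : MeasurableSet D) (hΩD : Ω ⊆ D) {u : Plane → Plane}
    (hflux : ∀ g : Plane → ℝ, ContDiff ℝ 1 g → HasCompactSupport g →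
      tsupport (fderiv ℝ g) ⊆ D → ∫ x in D, inner ℝ (u x) (gradient g x) = 0)
    {F : Plane → ℝ} (hF : IsNeumannTest Ω F) (h : ∀ x ∉ Ω, VanishesNear Ω F x) :
    ∫ x in Ω, inner ℝ (u x) (gradient F x) = 0 := by
  obtain ⟨h1, h2, h3⟩ := hF.extend hΩ h
  rw [← hflux _ h1 h2 (((tsupport_fderiv_subset ℝ).trans h3).trans hΩD),
    setIntegral_eq_of_subset_of_forall_sdiff_eq_zero hD hΩD]
  · apply setIntegral_congr_fun hΩ.measurableSet
    intro x hx
    simp only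
    rw [gradient_indicator hΩ fun hxΩ => absurd hx hxΩ, Set.indicator_of_mem hx]
  · intro x hx
    rw [gradient_indicator hΩ fun hxΩ => h x hxΩ, Set.indicator_of_notMem hx.2, inner_zero_right]

/-! ### Existence of the flow around the body -/

/-- Let `∇·Y = u · ∇χ` and `σ = a - χ`. Then the field `σ u + Y` acts on `∇ψ` as `u` acts on
`∇(σ ψ)`. If `Y` is `θ (∇χ)^⊥` with a stream function `θ` of `u`, then `a = 1` gives the comparison
field, and `a = 0` gives the difference of the comparison field and `u`. -/
theorem integral_inner_cutoff {Ω : Set Plane} (hΩ : IsOpen Ω) {u Y : Plane → Plane}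
    {χ σ : Plane → ℝ} (hu : MemLp u 2 (volume.restrict Ω))
    (hχ : ContDiff ℝ 1 χ) (hχc : HasCompactSupport (fderiv ℝ χ)) {c a : ℝ}
    (hb : ∀ x, |σ x| ≤ c) (hσ : ∀ x, σ x = a - χ x)
    (hY : ContDiff ℝ 1 Y) (hYc : HasCompactSupport Y) (hYs : tsupport Y ⊆ Ω)
    (hdiv : ∀ x ∈ Ω, divergence Y x = inner ℝ (u x) (gradient χ x))
    {ψ : Plane → ℝ} (hψ : IsNeumannTest Ω ψ) :
    ∫ x in Ω, inner ℝ (σ x • u x + Y x) (gradient ψ x) =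
      ∫ x in Ω, inner ℝ (u x) (gradient (fun y => σ y * ψ y) x) := by
  have hσd : ContDiff ℝ 1 σ := by
    rw [funext hσ]
    exact contDiff_const.sub hχ
  have hσf (x : Plane) : fderiv ℝ σ x = - fderiv ℝ χ x := by
    rw [funext hσ]; simp [fderiv_const_sub]
  have hσψ := hψ.mul_cutoff hΩ hσd hb (by rw [funext hσf]; exact hχc.neg)
  have hYm : MemLp Y 2 (volume.restrict Ω) :=
    (hY.continuous.memLp_of_hasCompactSupport hYc).restrict Ω
  have hdm : MemLp (divergence Y) 2 (volume.restrict Ω) :=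
    ((continuous_divergence hY).memLp_of_hasCompactSupport
      (hasCompactSupport_divergence hYc)).restrict Ω
  have hibp := integral_inner_gradient_eq_neg hΩ hψ.contDiffOn hY hYc hYs
  have hψd : IntegrableOn (fun x => ψ x * divergence Y x) Ω := hψ.memLp.integrable_mul hdm
  have hpt : ∀ x ∈ Ω, inner ℝ (σ x • u x + Y x) (gradient ψ x) =
      inner ℝ (u x) (gradient (fun y => σ y * ψ y) x) +
        (ψ x * divergence Y x + inner ℝ (gradient ψ x) (Y x)) := by
    intro x hx
    have h1 : gradient σ x = - gradient χ x := by simp [gradient, hσf]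
    rw [gradient_fun_mul (hσd.differentiable one_ne_zero x) (hψ.differentiableAt hΩ hx),
      hdiv x hx, h1, inner_add_left, inner_add_right, real_inner_smul_left, real_inner_smul_right,
      real_inner_smul_right, inner_neg_right, real_inner_comm (Y x)]
    ring
  have hi : IntegrableOn
      (fun x => ψ x * divergence Y x + inner ℝ (gradient ψ x) (Y x)) Ω :=
    hψd.add (integrableOn_inner hψ.memLp_gradient hYm)
  rw [setIntegral_congr_fun hΩ.measurableSet hpt,
    integral_add (integrableOn_inner hu hσψ.memLp_gradient) hi,
    integral_add hψd (integrableOn_inner hψ.memLp_gradient hYm), hibp, add_neg_cancel, add_zero]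

/-- Existence of the flow around the body: the projection onto gradients of the comparison field
`u₀`, which is solenoidal, agrees with `∇φ` near `∂D` and vanishes near `C`. -/
theorem exists_isFlowWithBody {D C : Set Plane} (hD : IsOpen D) (hC : IsClosed C) (hCD : C ⊆ D)
    (hbdd : Bornology.IsBounded (frontier D) ∨ Bornology.IsBounded (frontier C))
    {V : Plane → Plane} (hV : ContDiff ℝ 1 V) {φ : Plane → ℝ} (hφ : IsFlow D V φ)
    (hflux : ∀ g : Plane → ℝ, ContDiff ℝ 1 g → HasCompactSupport g →
      tsupport (fderiv ℝ g) ⊆ D → ∫ x in D, inner ℝ (gradient φ x) (gradient g x) = 0) :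
    ∃ φC : Plane → ℝ, IsFlowWithBody D C V φC := by
  set Ω := D \ C with hΩdef
  have hΩ : IsOpen Ω := hD.sdiff hC
  have hΩD : Ω ⊆ D := Set.sdiff_subset
  obtain ⟨χ, hχ, hχc, hχ1, hχ0, hχb⟩ := exists_cutoff hD hC hCD hbdd
  have hφ2 : ContDiffOn ℝ 2 φ D := hφ.potential.harmonic.contDiffOn
  have hφ1 : ContDiffOn ℝ 1 φ D := hφ2.of_le (by norm_num)
  have hχ' : ContDiff ℝ 1 χ := hχ.of_le (by norm_num)
  have hχΩ : tsupport (fderiv ℝ χ) ⊆ Ω := by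
    intro x hx
    have hconst (c : ℝ) (h : χ =ᶠ[𝓝 x] fun _ => c) : False := by
      refine notMem_tsupport_iff_eventuallyEq.2 ?_ hx
      refine h.fderiv.trans (Eventually.of_forall fun y => ?_)
      simp
    exact ⟨by_contra fun h => hconst 0 (hχ0 x h), fun h => hconst 1 (hχ1 x h)⟩
  -- The stream function is needed only where the cutoff function is not locally constant.
  obtain ⟨L, hL, hχL, hLΩ⟩ := exists_compact_between hχc.isCompact hΩ hχΩ
  have hcl : closure (interior L) ⊆ L := closure_minimal interior_subset hL.isClosed
  obtain ⟨θ, hθ⟩ := exists_stream_function hD hφ.potential.finite_energy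
    (continuousOn_gradient hD hφ1) (weaklyIrrotational_gradient hD hφ1) hflux isOpen_interior
    (hL.of_isClosed_subset isClosed_closure hcl) ((hcl.trans hLΩ).trans hΩD)
  have hLD : interior L ⊆ D := (interior_subset.trans hLΩ).trans hΩD
  have hθd : ContDiffOn ℝ 1 θ (interior L) := fun x hx => by
    refine (contDiffAt_one_iff.2 ⟨fun y => planeDual (rot (gradient φ y)), interior L,
      isOpen_interior.mem_nhds hx, ?_, fun y hy => (hθ y hy).hasFDerivAt⟩).contDiffWithinAt
    exact planeDual.continuous.comp_continuousOn (rot.continuous.comp_continuousOn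
      ((continuousOn_gradient hD hφ1).mono hLD))
  have hχg : ContDiff ℝ 1 fun x => rot (gradient χ x) :=
    rot.contDiff.comp (contDiff_gradient (n := 1) (by simpa [one_add_one_eq_two] using hχ))
  have hχgs : tsupport (fun x => rot (gradient χ x)) ⊆ tsupport (fderiv ℝ χ) :=
    closure_mono fun x hx h => hx (by simp [gradient, h])
  set Y : Plane → Plane := fun x => θ x • rot (gradient χ x) with hYdef
  have hY : ContDiff ℝ 1 Y :=
    contDiff_smul_of_tsupport_subset isOpen_interior hθd hχg (hχgs.trans hχL)
  have hYsub : Function.support Y ⊆ Function.support fun x => rot (gradient χ x) := by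
    intro x hx
    contrapose! hx
    simp [hYdef, Function.notMem_support.1 hx]
  have hYs : tsupport Y ⊆ tsupport (fderiv ℝ χ) := (closure_mono hYsub).trans hχgs
  have hYc : HasCompactSupport Y := hχc.isCompact.of_isClosed_subset (isClosed_tsupport _) hYs
  have hdivY : ∀ x, divergence Y x = inner ℝ (gradient φ x) (gradient χ x) := by
    intro x
    by_cases hx : x ∈ tsupport (fderiv ℝ χ)
    · have h1 := hθ x (hχL hx)
      rw [hYdef, divergence_smul h1.differentiableAt (hχg.differentiable one_ne_zero x),
        divergence_rot_gradient hχ, h1.gradient, inner_rot_rot, mul_zero, add_zero]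
    · rw [divergence_eq_zero_of_notMem fun h => hx (hYs h)]
      have : fderiv ℝ χ x = 0 := image_eq_zero_of_notMem_tsupport hx
      simp [gradient, this]
  have hχabs (a : ℝ) (ha : a ∈ Set.Icc (0 : ℝ) 1) (x : Plane) : |a - χ x| ≤ 1 := by
    rw [abs_le]
    constructor <;> linarith [(hχb x).1, (hχb x).2, ha.1, ha.2]
  have huΩ : MemLp (gradient φ) 2 (volume.restrict Ω) :=
    hφ.potential.finite_energy.mono_measure (Measure.restrict_mono_set _ hΩD)
  have hcut (a : ℝ) (ha : a ∈ Set.Icc (0 : ℝ) 1) {ψ : Plane → ℝ} (hψ : IsNeumannTest Ω ψ)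
      (hvan : ∀ x ∉ Ω, VanishesNear Ω (fun y => (a - χ y) * ψ y) x) :
      ∫ x in Ω, inner ℝ ((a - χ x) • gradient φ x + Y x) (gradient ψ x) = 0 := by
    rw [integral_inner_cutoff hΩ huΩ hχ' hχc (σ := fun x => a - χ x) (hχabs a ha)
      (fun x => rfl) hY hYc (hYs.trans hχΩ) (fun x _ => hdivY x) hψ]
    refine integral_inner_gradient_eq_zero_of_vanishesNear hΩ hD.measurableSet hΩD hflux
      (hψ.mul_cutoff hΩ (contDiff_const.sub hχ') (hχabs a ha) ?_) hvan
    have : fderiv ℝ (fun x => a - χ x) = - fderiv ℝ χ := by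
      ext1 x; simp [fderiv_const_sub]
    rw [this]
    exact hχc.neg
  set u₀ : Plane → Plane := fun x => (1 - χ x) • gradient φ x + Y x with hu₀
  have hYm : MemLp Y 2 (volume.restrict Ω) :=
    (hY.continuous.memLp_of_hasCompactSupport hYc).restrict Ω
  have hu₀m : MemLp u₀ 2 (volume.restrict Ω) :=
    (memLp_bdd_smul (continuous_const.sub hχ.continuous) (hχabs 1 (by simp)) huΩ).add hYm
  -- `u₀` satisfies the boundary condition on `∂C`, and on `∂D` the same condition as `∇φ`.
  have hbody {ψ : Plane → ℝ} (hψ : IsNeumannTest Ω ψ) (hv : ∀ x ∉ D, VanishesNear Ω ψ x) :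
      ∫ x in Ω, inner ℝ (u₀ x) (gradient ψ x) = 0 := by
    refine hcut 1 (by simp) hψ fun x hx => ?_
    by_cases hxD : x ∈ D
    · have hxC : x ∈ C := by_contra fun h => hx ⟨hxD, h⟩
      filter_upwards [hχ1 x hxC] with y hy _
      simp [hy]
    · filter_upwards [hv x hxD] with y hy hyΩ
      rw [hy hyΩ, mul_zero]
  have hdom {ψ : Plane → ℝ} (hψ : IsNeumannTest Ω ψ) (hv : ∀ x ∈ C, VanishesNear Ω ψ x) :
      ∫ x in Ω, inner ℝ (u₀ x - gradient φ x) (gradient ψ x) = 0 := by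
    rw [← hcut 0 (by simp) hψ fun x hx => ?_]
    · congr 1
      ext x
      congr 1
      simp only [hu₀]
      module
    · by_cases hxD : x ∈ D
      · have hxC : x ∈ C := by_contra fun h => hx ⟨hxD, h⟩
        filter_upwards [hv x hxC] with y hy hyΩ
        rw [hy hyΩ, mul_zero]
      · filter_upwards [hχ0 x hxD] with y hy _
        simp [hy]
  obtain ⟨v, hvm, hvcl, hvu⟩ := exists_projection hΩ hu₀m
  have hvsol : WeaklySolenoidal Ω v := by
    intro h hh hc hs
    have ht := isNeumannTest_of_hasCompactSupport Ω hh hc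
    rw [hvu h ht]
    refine hbody ht fun x hx => ?_
    filter_upwards [notMem_tsupport_iff_eventuallyEq.1 fun h' => hx (hΩD (hs h'))] with y hy _
    exact hy
  obtain ⟨φC, hφC, hφCv⟩ := exists_isPotentialFlow hΩ hvm hvcl hvsol
  have htest {ψ : Plane → ℝ} (hψ : IsNeumannTest Ω ψ) :
      ∫ x in Ω, inner ℝ (gradient φC x) (gradient ψ x) =
        ∫ x in Ω, inner ℝ (u₀ x) (gradient ψ x) := by
    rw [← hvu ψ hψ]
    refine integral_congr_ae ?_
    filter_upwards [hφCv] with x hx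
    rw [hx]
  refine ⟨φC, hφC, ?_, ?_⟩
  · rintro ψ hψ ⟨U, hU, hUf, hU0⟩
    have hv (x) (hx : x ∈ C) : VanishesNear Ω ψ x :=
      vanishesNear_of_notMem_frontier hΩ hU hU0 (fun h => h.2 hx) fun hxf => hUf
        ⟨hxf, fun hxD => by rw [hD.frontier_eq] at hxD; exact hxD.2 (hCD hx)⟩
    have hv' : ∀ x ∈ D \ Ω, VanishesNear Ω ψ x := fun x hx =>
      hv x (by_contra fun h => hx.2 ⟨hx.1, h⟩)
    have h1 := hφ.noFlux _ (hψ.extend_of_subset hΩ hv' hD.measurableSet)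
      ⟨∅, isOpen_empty, by simp, by simp⟩
    rw [setIntegral_noFlux_indicator hΩ hD.measurableSet hΩD hv'] at h1
    have h2 := hdom hψ hv
    simp only [inner_sub_left] at h2
    rw [integral_sub (integrableOn_inner hu₀m hψ.memLp_gradient)
      (integrableOn_inner huΩ hψ.memLp_gradient), ← htest hψ, ← integral_sub
      (integrableOn_inner hφC.finite_energy hψ.memLp_gradient)
      (integrableOn_inner huΩ hψ.memLp_gradient)] at h2
    have h3 := integral_add (hψ.integrableOn_noFlux hΩ hV huΩ)
      ((integrableOn_inner hφC.finite_energy hψ.memLp_gradient).sub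
        (integrableOn_inner huΩ hψ.memLp_gradient))
    simp only [Pi.sub_apply] at h3
    rw [h1, h2, add_zero] at h3
    rw [← h3]
    congr 1
    ext x
    simp only [inner_sub_left]
    ring
  · rintro ψ hψ ⟨U, hU, hUf, hU0⟩
    have hv (x) (hx : x ∉ D) : VanishesNear Ω ψ x :=
      vanishesNear_of_notMem_frontier hΩ hU hU0 (fun h => hx h.1) fun hxf => hUf
        ⟨hxf, fun hxC => hx (hCD (hC.frontier_subset hxC))⟩
    have h1 := htest hψ
    rw [hbody hψ hv] at h1
    simpa [divergence_zero] using h1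

/-! ### Density of test functions and the energy inequality -/

theorem hasGradientAt_comp_smul {η : Plane → ℝ} (hη : ContDiff ℝ 1 η) (c : ℝ) (x : Plane) :
    HasGradientAt (fun x => η (c • x)) (c • gradient η (c • x)) x := by
  have h1 := (hη.differentiable one_ne_zero (c • x)).hasFDerivAt.comp x
    ((hasFDerivAt_id x).const_smul c)
  rw [hasGradientAt_iff_hasFDerivAt]
  refine h1.congr_fderiv ?_
  ext v
  rw [InnerProductSpace.toDual_apply_apply, real_inner_smul_left, inner_gradient_left]
  simp

theorem abs_integral_inner_le {Ω : Set Plane} {u v : Plane → Plane}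
    (hu : MemLp u 2 (volume.restrict Ω)) (hv : MemLp v 2 (volume.restrict Ω)) :
    |∫ x in Ω, inner ℝ (u x) (v x)| ≤
      (eLpNorm u 2 (volume.restrict Ω)).toReal * √(∫ x in Ω, ‖v x‖ ^ 2) := by
  have h1 : ∫ x in Ω, ‖v x‖ ^ 2 = ‖hv.toLp‖ ^ 2 := by
    rw [← real_inner_self_eq_norm_sq, ← integral_inner_eq_inner_toLp hv hv]
    simp only [real_inner_self_eq_norm_sq]
  rw [h1, Real.sqrt_sq (norm_nonneg _), integral_inner_eq_inner_toLp hu hv, ← Lp.norm_toLp u hu]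
  exact abs_real_inner_le_norm _ _

/-- A field orthogonal to the gradients of test functions is orthogonal to the gradients of bounded
functions: in the plane, the Dirichlet integrals of the cutoff functions `x ↦ η (x / n)` do not
depend on `n`, hence their gradients converge weakly to zero. -/
theorem integral_inner_gradient_eq_zero_of_bounded {D : Set Plane} (hD : IsOpen D)
    {p : Plane → Plane} (hp : MemLp p 2 (volume.restrict D))
    (hpψ : ∀ ψ, IsNeumannTest D ψ → ∫ x in D, inner ℝ (p x) (gradient ψ x) = 0)
    {Φ : Plane → ℝ} (hΦ : ContDiffOn ℝ 1 Φ D) {M : ℝ} (hM : ∀ x ∈ D, |Φ x| ≤ M)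
    (hΦm : MemLp (gradient Φ) 2 (volume.restrict D)) :
    ∫ x in D, inner ℝ (p x) (gradient Φ x) = 0 := by
  obtain ⟨η, hη2, hηc, -, hη1, hηb⟩ := exists_contDiff_one_nhds
    (isCompact_closedBall (0 : Plane) 1) isOpen_univ (Set.subset_univ _)
  have hη : ContDiff ℝ 1 η := hη2.of_le (by norm_num)
  set c : ℕ → ℝ := fun n => 1 / ((n : ℝ) + 1) with hc
  have hc0 (n) : 0 < c n := Nat.one_div_pos_of_nat
  have hct : Tendsto c atTop (𝓝 0) := tendsto_one_div_add_atTop_nhds_zero_nat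
  set e : ℕ → Plane → ℝ := fun n x => η (c n • x) with he
  have hed (n) : ContDiff ℝ 1 (e n) := hη.comp (contDiff_const_smul (c n))
  have hec (n) : HasCompactSupport (e n) := hηc.comp_smul (hc0 n).ne'
  have hetest (n) := isNeumannTest_of_hasCompactSupport D (hed n) (hec n)
  have heb (n x) : |e n x| ≤ 1 := abs_le.2 ⟨by linarith [(hηb (c n • x)).1], (hηb _).2⟩
  have hnear (K : Set Plane) (hK : IsCompact K) : ∀ᶠ n in atTop, ∀ x ∈ K,
      e n =ᶠ[𝓝 x] fun _ => 1 := by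
    obtain ⟨R, hR⟩ := hK.isBounded.subset_closedBall 0
    have h1 : Tendsto (fun n => c n * R) atTop (𝓝 (0 * R)) := hct.mul_const R
    rw [zero_mul] at h1
    filter_upwards [h1.eventually (gt_mem_nhds one_pos)] with n hn x hx
    have hmem : c n • x ∈ Metric.closedBall (0 : Plane) 1 := by
      rw [mem_closedBall_zero_iff, norm_smul, Real.norm_of_nonneg (hc0 n).le]
      have := hR hx
      rw [mem_closedBall_zero_iff] at this
      have := mul_le_mul_of_nonneg_left this (hc0 n).le
      linarith
    have hcont : Tendsto (fun y : Plane => c n • y) (𝓝 x) (𝓝 (c n • x)) :=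
      (continuous_const_smul (c n)).continuousAt
    exact hcont.eventually (hη1 _ hmem)
  have hΦmeas : AEStronglyMeasurable Φ (volume.restrict D) :=
    hΦ.continuousOn.aestronglyMeasurable hD.measurableSet
  have hΦd (x) (hx : x ∈ D) : DifferentiableAt ℝ Φ x :=
    (hΦ.contDiffAt (hD.mem_nhds hx)).differentiableAt one_ne_zero
  have hΦsmul {E : Type} [NormedAddCommGroup E] [NormedSpace ℝ E] {f : Plane → E}
      (hf : MemLp f 2 (volume.restrict D)) : MemLp (fun x => Φ x • f x) 2 (volume.restrict D) :=
    hf.of_le_mul (c := M) (hΦmeas.smul hf.1) (by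
      filter_upwards [ae_restrict_mem hD.measurableSet] with x hx
      rw [norm_smul]
      exact mul_le_mul_of_nonneg_right (hM x hx) (norm_nonneg _))
  have hgm (n) : MemLp (fun x => e n x • gradient Φ x) 2 (volume.restrict D) :=
    memLp_bdd_smul (hed n).continuous (heb n) hΦm
  have hgrad (n) (x) (hx : x ∈ D) : gradient (fun y => e n y * Φ y) x =
      e n x • gradient Φ x + Φ x • gradient (e n) x :=
    gradient_fun_mul ((hed n).differentiable one_ne_zero x) (hΦd x hx)
  have htest (n) : IsNeumannTest D (fun x => e n x * Φ x) :=
    { contDiffOn := (hed n).contDiffOn.mul hΦ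
      memLp := by
        have := hΦsmul (hetest n).memLp
        simpa only [smul_eq_mul, mul_comm] using this
      memLp_gradient := ((hgm n).add (hΦsmul (hetest n).memLp_gradient)).ae_eq (by
        filter_upwards [ae_restrict_mem hD.measurableSet] with x hx
        exact (hgrad n x hx).symm)
      bounded_support := by
        obtain ⟨R, hR⟩ := (hetest n).bounded_support
        exact ⟨R, fun x hx h => by rw [hR x hx h, zero_mul]⟩ }
  have hΦp := hΦsmul hp
  have hzero (n) : (∫ x in D, e n x * inner ℝ (p x) (gradient Φ x)) +
      ∫ x in D, inner ℝ (Φ x • p x) (gradient (e n) x) = 0 := by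
    have h2 : IntegrableOn (fun x => e n x * inner ℝ (p x) (gradient Φ x)) D := by
      simpa only [real_inner_smul_right] using integrableOn_inner hp (hgm n)
    rw [← integral_add h2 (integrableOn_inner hΦp (hetest n).memLp_gradient), ← hpψ _ (htest n)]
    apply setIntegral_congr_fun hD.measurableSet
    intro x hx
    simp only
    rw [hgrad n x hx, inner_add_right, real_inner_smul_left, real_inner_smul_right,
      real_inner_smul_right]
  have hlim1 : Tendsto (fun n => ∫ x in D, e n x * inner ℝ (p x) (gradient Φ x)) atTop
      (𝓝 (∫ x in D, inner ℝ (p x) (gradient Φ x))) := by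
    have hi := integrableOn_inner hp hΦm
    refine tendsto_integral_of_dominated_convergence
      (fun x => ‖(inner ℝ (p x) (gradient Φ x) : ℝ)‖)
      (fun n => (hed n).continuous.aestronglyMeasurable.mul hi.1) hi.norm
      (fun n => Eventually.of_forall fun x => ?_) (Eventually.of_forall fun x => ?_)
    · rw [norm_mul]
      exact mul_le_of_le_one_left (norm_nonneg _) (heb n x)
    · refine tendsto_const_nhds.congr' ?_
      filter_upwards [hnear {x} isCompact_singleton] with n hn
      rw [(hn x rfl).eq_of_nhds, one_mul]
  have hegrad (n x) : gradient (e n) x = c n • gradient η (c n • x) :=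
    (hasGradientAt_comp_smul hη (c n) x).gradient
  have hgη : Continuous (gradient η) := (contDiff_gradient (n := 0) (by simpa using hη)).continuous
  set A : ℝ := ∫ x, ‖gradient η x‖ ^ 2 with hA
  have hDir (n) : ∫ x in D, ‖gradient (e n) x‖ ^ 2 ≤ A := by
    have hge : Continuous (gradient (e n)) :=
      (contDiff_gradient (n := 0) (by simpa using hed n)).continuous
    have hi : Integrable fun x => ‖gradient (e n) x‖ ^ 2 :=
      (hge.norm.pow 2).integrable_of_hasCompactSupport
        (HasCompactSupport.intro (hasCompactSupport_gradient (hec n)).isCompact fun x hx => by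
          rw [Pi.pow_apply, image_eq_zero_of_notMem_tsupport hx, norm_zero, zero_pow two_ne_zero])
    refine (setIntegral_le_integral hi (Eventually.of_forall fun x => by positivity)).trans_eq ?_
    have h1 := Measure.integral_comp_smul (volume : Measure Plane)
      (fun x => ‖gradient η x‖ ^ 2) (c n)
    simp only [finrank_euclideanSpace, Fintype.card_fin, smul_eq_mul] at h1
    simp only [hegrad, norm_smul, mul_pow, Real.norm_of_nonneg (hc0 n).le]
    rw [integral_const_mul, h1, abs_of_pos (by have := hc0 n; positivity), ← mul_assoc,
      mul_inv_cancel₀ (pow_ne_zero 2 (hc0 n).ne'), one_mul]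
  have hlim2 : Tendsto (fun n => ∫ x in D, inner ℝ (Φ x • p x) (gradient (e n) x)) atTop
      (𝓝 0) := by
    rw [Metric.tendsto_nhds]
    intro ε hε
    have hδ : 0 < ε / (√A + 1) := by positivity
    set q := D.indicator fun x => Φ x • p x with hq
    have hqm : MemLp q 2 := (memLp_indicator_iff_restrict hD.measurableSet).2 hΦp
    obtain ⟨g, hgc, hg, hgcont, hgm'⟩ := hqm.exists_hasCompactSupport_eLpNorm_sub_le (by norm_num)
      (ε := ENNReal.ofReal (ε / (√A + 1))) (by simpa using hδ)
    filter_upwards [hnear _ hgc.isCompact] with n hn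
    have hsame : ∫ x in D, inner ℝ (Φ x • p x) (gradient (e n) x) =
        ∫ x in D, inner ℝ ((q - g) x) (gradient (e n) x) := by
      apply setIntegral_congr_fun hD.measurableSet
      intro x hx
      simp only [Pi.sub_apply, hq, Set.indicator_of_mem hx, inner_sub_left]
      rw [eq_comm, sub_eq_self]
      by_cases hxg : x ∈ tsupport g
      · rw [(hn x hxg).gradient_eq, gradient_fun_const, inner_zero_right]
      · rw [image_eq_zero_of_notMem_tsupport hxg, inner_zero_left]
    rw [Real.dist_eq, sub_zero, hsame]
    refine (abs_integral_inner_le ((hqm.sub hgm').restrict D) (hetest n).memLp_gradient).trans_lt ?_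
    have h1 : (eLpNorm (q - g) 2 (volume.restrict D)).toReal ≤ ε / (√A + 1) :=
      ENNReal.toReal_le_of_le_ofReal hδ.le
        ((eLpNorm_mono_measure _ Measure.restrict_le_self).trans hg)
    calc _ ≤ ε / (√A + 1) * √A := by
          gcongr
          exact hDir n
      _ < ε := by
          rw [div_mul_eq_mul_div, div_lt_iff₀ (by positivity)]
          nlinarith [Real.sqrt_nonneg A]
  have hlim := hlim1.add hlim2
  simp only [hzero, add_zero] at hlim
  exact tendsto_nhds_unique hlim tendsto_const_nhds

/-- A field orthogonal to the gradients of test functions is orthogonal to all gradients in `L²`.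
Unbounded potentials are truncated by the functions `t ↦ k arctan (t / k)`. -/
theorem integral_inner_gradient_eq_zero_of_forall_test {D : Set Plane} (hD : IsOpen D)
    {p : Plane → Plane} (hp : MemLp p 2 (volume.restrict D))
    (hpψ : ∀ ψ, IsNeumannTest D ψ → ∫ x in D, inner ℝ (p x) (gradient ψ x) = 0)
    {φ : Plane → ℝ} (hφ : ContDiffOn ℝ 1 φ D) (hφm : MemLp (gradient φ) 2 (volume.restrict D)) :
    ∫ x in D, inner ℝ (p x) (gradient φ x) = 0 := by
  set c : ℕ → ℝ := fun n => 1 / ((n : ℝ) + 1) with hc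
  have hc0 (n) : 0 < c n := Nat.one_div_pos_of_nat
  have hct : Tendsto c atTop (𝓝 0) := tendsto_one_div_add_atTop_nhds_zero_nat
  set Φ : ℕ → Plane → ℝ := fun n x => (c n)⁻¹ * Real.arctan (c n * φ x) with hΦ
  have hΦd (n) : ContDiffOn ℝ 1 (Φ n) D :=
    contDiffOn_const.mul (Real.contDiff_arctan.comp_contDiffOn (contDiffOn_const.mul hφ))
  have hΦb (n) : ∀ x ∈ D, |Φ n x| ≤ (c n)⁻¹ * (Real.pi / 2) := fun x _ => by
    rw [hΦ, abs_mul, abs_of_pos (inv_pos.2 (hc0 n))]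
    refine mul_le_mul_of_nonneg_left ?_ (inv_pos.2 (hc0 n)).le
    exact abs_le.2 ⟨(Real.neg_pi_div_two_lt_arctan _).le, (Real.arctan_lt_pi_div_two _).le⟩
  set s : ℕ → Plane → ℝ := fun n x => 1 / (1 + (c n * φ x) ^ 2) with hs
  have hs1 (n x) : |s n x| ≤ 1 := by
    have : 0 < 1 + (c n * φ x) ^ 2 := by positivity
    rw [abs_of_pos (by positivity), hs, div_le_one this]
    nlinarith [sq_nonneg (c n * φ x)]
  have hgrad (n) (x) (hx : x ∈ D) : gradient (Φ n) x = s n x • gradient φ x := by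
    have h1 : HasFDerivAt φ (fderiv ℝ φ x) x :=
      ((hφ.contDiffAt (hD.mem_nhds hx)).differentiableAt one_ne_zero).hasFDerivAt
    have h2 := ((h1.const_mul (c n)).arctan).const_mul (c n)⁻¹
    have h3 : HasGradientAt (Φ n) (s n x • gradient φ x) x := by
      rw [hasGradientAt_iff_hasFDerivAt]
      refine h2.congr_fderiv ?_
      ext v
      rw [InnerProductSpace.toDual_apply_apply, real_inner_smul_left, inner_gradient_left]
      simp only [smul_apply, smul_eq_mul, hs]
      have := (hc0 n).ne'
      field_simp
    exact h3.gradient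
  have hsc (n) : ContinuousOn (s n) D := by
    refine continuousOn_const.div ?_ fun x _ => by positivity
    exact continuousOn_const.add ((continuousOn_const.mul hφ.continuousOn).pow 2)
  have hsm (n) : AEStronglyMeasurable (s n) (volume.restrict D) :=
    (hsc n).aestronglyMeasurable hD.measurableSet
  have hΦm (n) : MemLp (gradient (Φ n)) 2 (volume.restrict D) := by
    refine (hφm.of_le_mul (c := 1) ((hsm n).smul hφm.1)
      (Eventually.of_forall fun x => ?_)).ae_eq (f := fun x => s n x • gradient φ x) ?_
    · rw [Pi.smul_apply', norm_smul]
      exact mul_le_mul_of_nonneg_right (hs1 n x) (norm_nonneg _)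
    · filter_upwards [ae_restrict_mem hD.measurableSet] with x hx
      exact (hgrad n x hx).symm
  have hzero (n) : ∫ x in D, s n x * inner ℝ (p x) (gradient φ x) = 0 := by
    rw [← integral_inner_gradient_eq_zero_of_bounded hD hp hpψ (hΦd n) (hΦb n) (hΦm n)]
    apply setIntegral_congr_fun hD.measurableSet
    intro x hx
    simp only
    rw [hgrad n x hx, real_inner_smul_right]
  have hi := integrableOn_inner hp hφm
  have hlim : Tendsto (fun n => ∫ x in D, s n x * inner ℝ (p x) (gradient φ x)) atTop
      (𝓝 (∫ x in D, inner ℝ (p x) (gradient φ x))) := by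
    refine tendsto_integral_of_dominated_convergence
      (fun x => ‖(inner ℝ (p x) (gradient φ x) : ℝ)‖)
      (fun n => (hsm n).mul hi.1) hi.norm
      (fun n => Eventually.of_forall fun x => ?_) (Eventually.of_forall fun x => ?_)
    · rw [norm_mul]
      exact mul_le_of_le_one_left (norm_nonneg _) (hs1 n x)
    · have h1 : Tendsto (fun n => s n x) atTop (𝓝 (1 / (1 + (0 * φ x) ^ 2))) :=
        tendsto_const_nhds.div (tendsto_const_nhds.add ((hct.mul_const _).pow 2)) (by positivity)
      simpa using h1.mul_const (inner ℝ (p x) (gradient φ x))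
  simp only [hzero] at hlim
  exact tendsto_nhds_unique hlim tendsto_const_nhds

/-- The flow around the body, extended by zero to the body, satisfies the same weak equations on `D`
as the flow without the body. -/
theorem IsFlowWithBody.integral_inner_sub_eq_zero {D C : Set Plane} (hD : IsOpen D)
    (hC : IsClosed C) (hCD : C ⊆ D)
    (hbdd : Bornology.IsBounded (frontier D) ∨ Bornology.IsBounded (frontier C))
    {V : Plane → Plane} (hV : ContDiff ℝ 1 V) {φ : Plane → ℝ} (hφ : IsFlow D V φ)
    (hflux : ∀ g : Plane → ℝ, ContDiff ℝ 1 g → HasCompactSupport g →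
      tsupport (fderiv ℝ g) ⊆ D → ∫ x in D, inner ℝ (gradient φ x) (gradient g x) = 0)
    {φC : Plane → ℝ} (hφC : IsFlowWithBody D C V φC) {ψ : Plane → ℝ} (hψ : IsNeumannTest D ψ) :
    ∫ x in D, inner ℝ ((D \ C).indicator (gradient φC) x - gradient φ x) (gradient ψ x) = 0 := by
  set Ω := D \ C with hΩdef
  have hΩ : IsOpen Ω := hD.sdiff hC
  have hΩD : Ω ⊆ D := Set.sdiff_subset
  obtain ⟨χ, hχ2, hχc, hχ1, hχ0, hχb⟩ := exists_cutoff hD hC hCD hbdd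
  have hχ : ContDiff ℝ 1 χ := hχ2.of_le (by norm_num)
  set σ : Plane → ℝ := fun x => 1 - χ x with hσ
  have hσd : ContDiff ℝ 1 σ := contDiff_const.sub hχ
  have hσc : HasCompactSupport (fderiv ℝ σ) := by
    have : fderiv ℝ σ = - fderiv ℝ χ := by ext1 x; simp [hσ, fderiv_const_sub]
    rw [this]; exact hχc.neg
  -- `σ ψ` vanishes near `C` and `χ ψ` vanishes near `∂D`.
  have hψ1 : IsNeumannTest D fun x => σ x * ψ x := hψ.mul_cutoff hD hσd (c := 1) (fun x => by
    rw [abs_le]; constructor <;> simp only [hσ] <;> linarith [(hχb x).1, (hχb x).2]) hσc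
  have hψ2 : IsNeumannTest D fun x => χ x * ψ x := hψ.mul_cutoff hD hχ (c := 1) (fun x => by
    rw [abs_le]; constructor <;> linarith [(hχb x).1, (hχb x).2]) hχc
  have hum : MemLp (Ω.indicator (gradient φC)) 2 (volume.restrict D) :=
    ((memLp_indicator_iff_restrict hΩ.measurableSet).2 hφC.potential.finite_energy).restrict D
  have hφm := hφ.potential.finite_energy
  have hind {f : Plane → Plane} :
      ∫ x in D, inner ℝ (Ω.indicator (gradient φC) x) (f x) =
        ∫ x in Ω, inner ℝ (gradient φC x) (f x) := by
    rw [setIntegral_eq_of_subset_of_forall_sdiff_eq_zero hD.measurableSet hΩD]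
    · apply setIntegral_congr_fun hΩ.measurableSet
      intro x hx
      simp only [Set.indicator_of_mem hx]
    · intro x hx
      rw [Set.indicator_of_notMem hx.2, inner_zero_left]
  have hdiff {F : Plane → ℝ} (hF : IsNeumannTest D F) :
      ∫ x in D, inner ℝ (Ω.indicator (gradient φC) x - gradient φ x) (gradient F x) =
        (∫ x in Ω, inner ℝ (gradient φC x) (gradient F x)) -
          ∫ x in D, inner ℝ (gradient φ x) (gradient F x) := by
    simp only [inner_sub_left]
    rw [integral_sub (integrableOn_inner hum hF.memLp_gradient)
      (integrableOn_inner hφm hF.memLp_gradient), hind]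
  have hA : ∫ x in D, inner ℝ (Ω.indicator (gradient φC) x - gradient φ x)
      (gradient (fun y => σ y * ψ y) x) = 0 := by
    have h1 := hφC.noFlux_domain _ (hψ1.mono hΩD) ⟨interior {x | χ x = 1}, isOpen_interior, ?_, ?_⟩
    · have h2 := hφ.noFlux _ hψ1 ⟨∅, isOpen_empty, by simp, by simp⟩
      have hvan : ∀ x ∈ D \ Ω, (fun y => σ y * ψ y) =ᶠ[𝓝 x] fun _ => 0 := fun x hx => by
        have hxC : x ∈ C := by_contra fun h => hx.2 ⟨hx.1, h⟩
        filter_upwards [hχ1 x hxC] with y hy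
        simp [hσ, hy]
      have hsub {w : Plane → Plane} {f : Plane → ℝ} :
          ∫ x in D, (inner ℝ (w x) (gradient (fun y => σ y * ψ y) x) - σ x * ψ x * f x) =
          ∫ x in Ω, (inner ℝ (w x) (gradient (fun y => σ y * ψ y) x) - σ x * ψ x * f x) := by
        refine setIntegral_eq_of_subset_of_forall_sdiff_eq_zero hD.measurableSet hΩD
          fun x hx => ?_
        have hx0 : σ x * ψ x = 0 := (hvan x hx).eq_of_nhds
        rw [(hvan x hx).gradient_eq, gradient_fun_const, hx0]
        simp
      have h3 := hsub (w := gradient φ) (f := fun _ => 0)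
      simp only [mul_zero, sub_zero] at h3
      rw [hsub] at h2
      rw [hdiff hψ1, h3, ← integral_sub (integrableOn_inner hφC.potential.finite_energy
        (hψ1.mono hΩD).memLp_gradient) (integrableOn_inner (hφm.mono_measure
        (Measure.restrict_mono_set _ hΩD)) (hψ1.mono hΩD).memLp_gradient)]
      have h4 := integral_sub ((hψ1.mono hΩD).integrableOn_noFlux hΩ hV
        hφC.potential.finite_energy) ((hψ1.mono hΩD).integrableOn_noFlux hΩ hV
        (hφm.mono_measure (Measure.restrict_mono_set _ hΩD)))
      rw [h1, h2, sub_zero] at h4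
      rw [← h4]
      congr 1
      ext x
      simp only [inner_sub_left]
      ring
    · intro x hx
      have hxΩ : x ∉ Ω := by rw [hΩ.frontier_eq] at hx; exact hx.1.2
      have hxcl : x ∈ closure D := closure_mono hΩD (frontier_subset_closure hx.1)
      have hxD : x ∈ D := by
        by_contra h
        exact hx.2 (by rw [hD.frontier_eq]; exact ⟨hxcl, h⟩)
      exact mem_interior_iff_mem_nhds.2 (hχ1 x (by_contra fun h => hxΩ ⟨hxD, h⟩))
    · intro x hx
      have : χ x = 1 := interior_subset (s := {x | χ x = 1}) hx.1
      simp [hσ, this]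
  have hB : ∫ x in D, inner ℝ (Ω.indicator (gradient φC) x - gradient φ x)
      (gradient (fun y => χ y * ψ y) x) = 0 := by
    have h1 := hφC.noFlux_body _ (hψ2.mono hΩD) ⟨interior {x | χ x = 0}, isOpen_interior, ?_, ?_⟩
    · have h2 := integral_inner_gradient_eq_zero_of_vanishesNear hD hD.measurableSet subset_rfl
        hflux hψ2 fun x hx => by
          filter_upwards [hχ0 x hx] with y hy _
          simp [hy]
      rw [hdiff hψ2, h2]
      simpa [divergence_zero] using h1
    · intro x hx
      have hxΩ : x ∉ Ω := by rw [hΩ.frontier_eq] at hx; exact hx.1.2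
      refine mem_interior_iff_mem_nhds.2 (hχ0 x fun hxD => ?_)
      have hxC : x ∈ C := by_contra fun h => hxΩ ⟨hxD, h⟩
      refine hx.2 ?_
      rw [frontier_eq_closure_inter_closure]
      refine ⟨subset_closure hxC, closure_mono ?_ (frontier_subset_closure hx.1)⟩
      exact fun y hy => hy.2
    · intro x hx
      have : χ x = 0 := interior_subset (s := {x | χ x = 0}) hx.1
      simp [this]
  have hpm := hum.sub hφm
  have h3 := integral_add (integrableOn_inner hpm hψ1.memLp_gradient)
    (integrableOn_inner hpm hψ2.memLp_gradient)
  simp only [Pi.sub_apply] at h3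
  rw [hA, hB, add_zero] at h3
  rw [← h3]
  apply setIntegral_congr_fun hD.measurableSet
  intro x hx
  simp only
  rw [← inner_add_right, ← gradient_fun_add (hψ1.differentiableAt hD hx)
    (hψ2.differentiableAt hD hx)]
  congr 2
  ext y
  simp only [hσ]
  ring

/-- The field around the body, extended by zero, differs from `∇φ` by a field orthogonal to `∇φ`. -/
theorem IsFlowWithBody.integral_norm_sq_le {D C : Set Plane} (hD : IsOpen D)
    (hC : IsClosed C) (hCD : C ⊆ D)
    (hbdd : Bornology.IsBounded (frontier D) ∨ Bornology.IsBounded (frontier C))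
    {V : Plane → Plane} (hV : ContDiff ℝ 1 V) {φ : Plane → ℝ} (hφ : IsFlow D V φ)
    (hflux : ∀ g : Plane → ℝ, ContDiff ℝ 1 g → HasCompactSupport g →
      tsupport (fderiv ℝ g) ⊆ D → ∫ x in D, inner ℝ (gradient φ x) (gradient g x) = 0)
    {φC : Plane → ℝ} (hφC : IsFlowWithBody D C V φC) :
    ∫ x in D, ‖gradient φ x‖ ^ 2 ≤ ∫ x in D \ C, ‖gradient φC x‖ ^ 2 := by
  have hΩ : IsOpen (D \ C) := hD.sdiff hC
  set u := (D \ C).indicator (gradient φC) with hu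
  have hum : MemLp u 2 (volume.restrict D) :=
    ((memLp_indicator_iff_restrict hΩ.measurableSet).2 hφC.potential.finite_energy).restrict D
  have hφm := hφ.potential.finite_energy
  have hpm : MemLp (fun x => u x - gradient φ x) 2 (volume.restrict D) := hum.sub hφm
  have horth := integral_inner_gradient_eq_zero_of_forall_test hD hpm
    (fun ψ hψ => hφC.integral_inner_sub_eq_zero hD hC hCD hbdd hV hφ hflux hψ)
    (hφ.potential.harmonic.contDiffOn.of_le (by norm_num)) hφm
  have hsq {f : Plane → Plane} (hf : MemLp f 2 (volume.restrict D)) :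
      IntegrableOn (fun x => ‖f x‖ ^ 2) D := by
    simpa only [real_inner_self_eq_norm_sq] using integrableOn_inner hf hf
  have hE : ∫ x in D \ C, ‖gradient φC x‖ ^ 2 = ∫ x in D, ‖u x‖ ^ 2 := by
    rw [setIntegral_eq_of_subset_of_forall_sdiff_eq_zero hD.measurableSet
      (Set.sdiff_subset : D \ C ⊆ D)]
    · apply setIntegral_congr_fun hΩ.measurableSet
      intro x hx
      simp only [hu, Set.indicator_of_mem hx]
    · intro x hx
      simp [hu, Set.indicator_of_notMem hx.2]
  have hpt (x : Plane) : ‖u x‖ ^ 2 = ‖gradient φ x‖ ^ 2 +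
      (2 * inner ℝ (u x - gradient φ x) (gradient φ x) + ‖u x - gradient φ x‖ ^ 2) := by
    have := norm_add_sq_real (u x - gradient φ x) (gradient φ x)
    rw [sub_add_cancel] at this
    linarith
  have hi2 : IntegrableOn (fun x => 2 * (inner ℝ (u x - gradient φ x) (gradient φ x) : ℝ)) D :=
    (integrableOn_inner hpm hφm).const_mul 2
  have hi : IntegrableOn (fun x => 2 * (inner ℝ (u x - gradient φ x) (gradient φ x) : ℝ) +
      ‖u x - gradient φ x‖ ^ 2) D := hi2.add (hsq hpm)
  rw [hE]
  simp only [hpt]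
  rw [integral_add (hsq hφm) hi, integral_add hi2 (hsq hpm), integral_const_mul, horth, mul_zero,
    zero_add]
  exact le_add_of_nonneg_right (integral_nonneg fun x => by positivity)

end

theorem corollary1 (ρ : ℝ) (hρ : 0 < ρ)
    (N : ℕ) (B : Fin N → Set Plane)
    (hBclosed : ∀ i, IsClosed (B i)) (hBconn : ∀ i, IsConnected (B i))
    (hBdisj : Pairwise (fun i j => Disjoint (B i) (B j)))
    (D : Set Plane) (hD : D = (⋃ i, B i)ᶜ)
    (V : Plane → Plane) (hV : ContDiff ℝ 1 V)
    (hvol : ∀ i, Bornology.IsBounded (B i) → ∫ x in B i, divergence V x = 0)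
    (φ : Plane → ℝ) (hφ : IsFlow D V φ)
    (C : Set Plane) (hC : IsClosed C) (hCD : C ⊆ D)
    (hbdd : Bornology.IsBounded (frontier D) ∨ Bornology.IsBounded (frontier C)) :
    (∃ φC : Plane → ℝ, IsFlowWithBody D C V φC) ∧
      ∀ φC : Plane → ℝ, IsFlowWithBody D C V φC →
        kineticEnergy ρ D (gradient φ) ≤ kineticEnergy ρ (D \ C) (gradient φC) := by
  have hDo : IsOpen D := by
    rw [hD]
    exact (isClosed_iUnion_of_finite hBclosed).isOpen_compl
  have hflux : ∀ g : Plane → ℝ, ContDiff ℝ 1 g → HasCompactSupport g →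
      tsupport (fderiv ℝ g) ⊆ D → ∫ x in D, inner ℝ (gradient φ x) (gradient g x) = 0 :=
    fun g hg hc hs => hφ.integral_inner_gradient_eq_zero hBclosed hBconn hBdisj hD hV hvol hg hc hs
  refine ⟨exists_isFlowWithBody hDo hC hCD hbdd hV hφ hflux, fun φC hφC => ?_⟩
  have h := hφC.integral_norm_sq_le hDo hC hCD hbdd hV hφ hflux
  unfold kineticEnergy
  gcongr
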